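/- For $\alpha>-1$ let $\|f\|_{w_\alpha}=\big(\int_0^\infty |f(x)|^2x^\alpha e^{-x}\,dx\big)^{1/2}$, and for $n\in\mathbb N$ let $$c_n(\alpha)=\sup\Big\{\frac{\|p'\|_{w_\alpha}}{\|p\|_{w_\alpha}} : p \text{ a nonzero real polynomial of degree at most } n\Big\}$$ be the best constant in the Markov inequality $\|p'\|_{w_\alpha}\le c_n(\alpha)\|p\|_{w_\alpha}$; this supremum is finite. Then for every $\alpha>-1$ the limit $c(\alpha)=\lim_{n\to\infty} c_n(\alpha)/n$ exists and $$\underline c(\alpha)<c(\alpha)<\overline c(\alpha),$$ where $\underline c(\alpha),\overline c(\alpha)>0$ are given by $$\underline c^2(\alpha)=\frac{21\alpha^3+299\alpha^2+1391\alpha+2073}{(\alpha+1)(\alpha+3)(\alpha+5)(\alpha+11)(7\alpha+31)}$$ and $$\overline c^{\,2}(\alpha)=\begin{cases}\dfrac{\big(21\alpha^3+299\alpha^2+1391\alpha+2073\big)^{1/6}}{(\alpha+1)(\alpha+3)^{1/2}(\alpha+5)^{1/3}\big[(\alpha+7)(\alpha+9)(\alpha+11)\big]^{1/6}}, & -1<\alpha\le\alpha^\star,\\[2mm]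 \dfrac{4}{\alpha^2+10\alpha+8}, & \alpha>\alpha^\star.\end{cases}$$ Here $\alpha^\star$ is the unique number in $(-1,\infty)$ at which the two expressions in the definition of $\overline c^{\,2}$ coincide, and $\alpha^\star\approx172$; precisely, $|\alpha^\star-172|<\tfrac1{10}$. -/

import Mathlib

open Filter Topology MeasureTheory

noncomputable section

/-- The Laguerre weight `w_α(x) = x ^ α * e ^ (-x)`, used on `(0, ∞)`. -/
def laguerreWeight (α x : ℝ) : ℝ := x ^ α * Real.exp (-x)

/-- The weighted `L₂`-norm of a real polynomial on `(0, ∞)` with respect to `w_α`. -/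
def laguerreNorm (α : ℝ) (p : Polynomial ℝ) : ℝ :=
  Real.sqrt (∫ x in Set.Ioi (0 : ℝ), |p.eval x| ^ 2 * laguerreWeight α x)

/-- The quotients `‖p'‖ / ‖p‖`, where `p` runs over the nonzero polynomials of degree `≤ n`. -/
def markovQuotients (n : ℕ) (α : ℝ) : Set ℝ :=
  {r | ∃ p : Polynomial ℝ, p ≠ 0 ∧ p.natDegree ≤ n ∧
    r = laguerreNorm α (Polynomial.derivative p) / laguerreNorm α p}

/-- The best Markov constant `c_n(α)`. -/
def markovConst (n : ℕ) (α : ℝ) : ℝ := sSup (markovQuotients n α)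

/-- The lower bound for `c(α) ^ 2`. -/
def lowerSq (α : ℝ) : ℝ :=
  (21 * α ^ 3 + 299 * α ^ 2 + 1391 * α + 2073) /
    ((α + 1) * (α + 3) * (α + 5) * (α + 11) * (7 * α + 31))

/-- The upper bound for `c(α) ^ 2` used for moderate `α`. -/
def upperSqSmall (α : ℝ) : ℝ :=
  (21 * α ^ 3 + 299 * α ^ 2 + 1391 * α + 2073) ^ (1 / 6 : ℝ) /
    ((α + 1) * (α + 3) ^ (1 / 2 : ℝ) * (α + 5) ^ (1 / 3 : ℝ) *
      ((α + 7) * (α + 9) * (α + 11)) ^ (1 / 6 : ℝ))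

/-- The upper bound for `c(α) ^ 2` used for large `α`. -/
def upperSqLarge (α : ℝ) : ℝ := 4 / (α ^ 2 + 10 * α + 8)

/-- The upper bound for `c(α) ^ 2` with switching point `αs`. -/
def upperSq (αs α : ℝ) : ℝ := if α ≤ αs then upperSqSmall α else upperSqLarge α

end

noncomputable section

open Polynomial

/-! ### The Laguerre functional -/

/-- Integration of a polynomial against the Laguerre weight. -/
def laguerreInt (α : ℝ) (p : ℝ[X]) : ℝ :=
  ∫ x in Set.Ioi (0 : ℝ), p.eval x * laguerreWeight α x

lemma integrableOn_monomial_laguerreWeight {α : ℝ} (hα : -1 < α) (i : ℕ) :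
    IntegrableOn (fun x : ℝ => x ^ i * laguerreWeight α x) (Set.Ioi 0) ∧
      ∫ x in Set.Ioi (0 : ℝ), x ^ i * laguerreWeight α x = Real.Gamma (α + 1 + i) := by
  have hs : 0 < α + 1 + i := by have : (0 : ℝ) ≤ i := i.cast_nonneg; linarith
  have hE : Set.EqOn (fun x : ℝ => Real.exp (-x) * x ^ (α + 1 + i - 1))
      (fun x : ℝ => x ^ i * laguerreWeight α x) (Set.Ioi 0) := by
    intro x hx
    have hx : (0 : ℝ) < x := hx
    simp only [laguerreWeight]
    rw [show α + 1 + i - 1 = α + (i : ℝ) by ring, Real.rpow_add hx, Real.rpow_natCast]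
    ring
  refine ⟨(Real.GammaIntegral_convergent hs).congr_fun hE measurableSet_Ioi, ?_⟩
  rw [Real.Gamma_eq_integral hs]
  exact (setIntegral_congr_fun measurableSet_Ioi hE).symm

lemma integrableOn_eval_laguerreWeight {α : ℝ} (hα : -1 < α) (p : ℝ[X]) :
    IntegrableOn (fun x : ℝ => p.eval x * laguerreWeight α x) (Set.Ioi 0) := by
  induction p using Polynomial.induction_on' with
  | add p q hp hq =>
    simp only [eval_add, add_mul]
    exact hp.add hq
  | monomial n a =>
    simp only [eval_monomial, mul_assoc]
    exact (integrableOn_monomial_laguerreWeight hα n).1.const_mul a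

lemma laguerreInt_add {α : ℝ} (hα : -1 < α) (p q : ℝ[X]) :
    laguerreInt α (p + q) = laguerreInt α p + laguerreInt α q := by
  simp only [laguerreInt, eval_add, add_mul]
  exact integral_add (integrableOn_eval_laguerreWeight hα p)
    (integrableOn_eval_laguerreWeight hα q)

lemma laguerreInt_C_mul (α : ℝ) (a : ℝ) (p : ℝ[X]) :
    laguerreInt α (C a * p) = a * laguerreInt α p := by
  simp only [laguerreInt, eval_mul, eval_C, mul_assoc]
  exact integral_const_mul a _

lemma laguerreInt_monomial {α : ℝ} (hα : -1 < α) (n : ℕ) (a : ℝ) :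
    laguerreInt α (monomial n a) = a * Real.Gamma (α + 1 + n) := by
  simp only [laguerreInt, eval_monomial, mul_assoc]
  rw [integral_const_mul, (integrableOn_monomial_laguerreWeight hα n).2]

/-- `laguerreInt` as a linear map. -/
def laguerreLin {α : ℝ} (hα : -1 < α) : ℝ[X] →ₗ[ℝ] ℝ where
  toFun := laguerreInt α
  map_add' := laguerreInt_add hα
  map_smul' a p := by rw [smul_eq_C_mul, laguerreInt_C_mul]; rfl

/-- Integration by parts against the Laguerre weight. -/
lemma laguerreLin_X_mul_derivative {α : ℝ} (hα : -1 < α) (p : ℝ[X]) :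
    laguerreLin hα (X * derivative p) = laguerreLin hα ((X - C (α + 1)) * p) := by
  induction p using Polynomial.induction_on' with
  | add p q hp hq => rw [derivative_add, mul_add, mul_add, map_add, map_add, hp, hq]
  | monomial n a =>
    rw [sub_mul, map_sub, ← smul_eq_C_mul, map_smul]
    change laguerreInt α _ = laguerreInt α _ - (α + 1) • laguerreInt α _
    rw [X_mul_monomial, laguerreInt_monomial hα, laguerreInt_monomial hα]
    have hs : α + 1 + n ≠ 0 := by have : (0 : ℝ) ≤ n := n.cast_nonneg; linarith
    have h1 : Real.Gamma (α + 1 + ((n + 1 : ℕ) : ℝ)) = (α + 1 + n) * Real.Gamma (α + 1 + n) := by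
      rw [← Real.Gamma_add_one hs]; congr 1; push_cast; ring
    rw [h1, derivative_monomial]
    cases n with
    | zero =>
      have h0 : laguerreInt α 0 = 0 := map_zero (laguerreLin hα)
      simp [h0]; ring
    | succ k =>
      rw [Nat.add_sub_cancel, X_mul_monomial, laguerreInt_monomial hα, smul_eq_mul]
      ring

lemma laguerreNorm_eq (α : ℝ) (p : ℝ[X]) : laguerreNorm α p = √(laguerreInt α (p * p)) := by
  simp only [laguerreNorm, laguerreInt, sq_abs, ← pow_two, eval_pow]

/-! ### Laguerre polynomials -/

/-- The Laguerre polynomial `L_n^{(α)}`. -/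
def laguerrePoly (α : ℝ) : ℕ → ℝ[X]
  | 0 => 1
  | n + 1 => C ((n + 1 : ℝ)⁻¹) *
      ((C (n + 1 + α) - X) * laguerrePoly α n + X * derivative (laguerrePoly α n))

lemma laguerrePoly_succ (α : ℝ) (n : ℕ) :
    C (n + 1 : ℝ) * laguerrePoly α (n + 1) =
      (C (n + 1 + α) - X) * laguerrePoly α n + X * derivative (laguerrePoly α n) := by
  have : (n + 1 : ℝ) ≠ 0 := by positivity
  rw [laguerrePoly, ← mul_assoc, ← C_mul, mul_inv_cancel₀ this, C_1, one_mul]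

lemma derivative_laguerrePoly_succ_of_ode (α : ℝ) (n : ℕ)
    (h : X * derivative (derivative (laguerrePoly α n))
      + (C (α + 1) - X) * derivative (laguerrePoly α n) + C (n : ℝ) * laguerrePoly α n = 0) :
    derivative (laguerrePoly α (n + 1)) = derivative (laguerrePoly α n) - laguerrePoly α n := by
  have h1 := congrArg derivative (laguerrePoly_succ α n)
  have h0 : (C (n + 1 : ℝ)) ≠ 0 := by
    rw [Ne, C_eq_zero]; positivity
  apply mul_left_cancel₀ h0
  simp only [derivative_mul, derivative_add, derivative_sub, derivative_C, derivative_X,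
    zero_mul, zero_add, zero_sub, one_mul] at h1
  rw [h1]
  simp only [map_add, C_1] at h ⊢
  linear_combination h

lemma laguerrePoly_ode (α : ℝ) (n : ℕ) :
    X * derivative (derivative (laguerrePoly α n))
      + (C (α + 1) - X) * derivative (laguerrePoly α n) + C (n : ℝ) * laguerrePoly α n = 0 := by
  induction n with
  | zero => simp [laguerrePoly]
  | succ n ih =>
    have h1 := derivative_laguerrePoly_succ_of_ode α n ih
    have h2 := laguerrePoly_succ α n
    rw [h1, derivative_sub]
    push_cast
    simp only [map_add, C_1] at ih h2 ⊢
    linear_combination ih + h2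

lemma derivative_laguerrePoly_succ (α : ℝ) (n : ℕ) :
    derivative (laguerrePoly α (n + 1)) = derivative (laguerrePoly α n) - laguerrePoly α n :=
  derivative_laguerrePoly_succ_of_ode α n (laguerrePoly_ode α n)

lemma X_mul_derivative_laguerrePoly (α : ℝ) (n : ℕ) :
    X * derivative (laguerrePoly α (n + 1)) =
      C (n + 1 : ℝ) * laguerrePoly α (n + 1) - C (n + 1 + α) * laguerrePoly α n := by
  rw [derivative_laguerrePoly_succ, laguerrePoly_succ]
  ring

lemma laguerreLin_X_mul_derivative_mul {α : ℝ} (hα : -1 < α) (n : ℕ) (q : ℝ[X]) :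
    laguerreLin hα (X * derivative (laguerrePoly α n) * derivative q) =
      n * laguerreLin hα (laguerrePoly α n * q) := by
  have h := laguerreLin_X_mul_derivative hα (derivative (laguerrePoly α n) * q)
  rw [← sub_eq_zero, ← map_sub] at h
  have e : X * derivative (derivative (laguerrePoly α n) * q)
      - (X - C (α + 1)) * (derivative (laguerrePoly α n) * q)
      = X * derivative (laguerrePoly α n) * derivative q
        - (n : ℝ) • (laguerrePoly α n * q) := by
    rw [derivative_mul, smul_eq_C_mul]
    linear_combination q * laguerrePoly_ode α n
  rw [e, map_sub, map_smul, sub_eq_zero, smul_eq_mul] at h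
  exact h

lemma laguerrePoly_orthogonal {α : ℝ} (hα : -1 < α) {m n : ℕ} (h : m ≠ n) :
    laguerreLin hα (laguerrePoly α m * laguerrePoly α n) = 0 := by
  have h1 := laguerreLin_X_mul_derivative_mul hα m (laguerrePoly α n)
  have h2 := laguerreLin_X_mul_derivative_mul hα n (laguerrePoly α m)
  rw [show X * derivative (laguerrePoly α n) * derivative (laguerrePoly α m)
    = X * derivative (laguerrePoly α m) * derivative (laguerrePoly α n) by ring, h1,
    mul_comm (laguerrePoly α n)] at h2
  have h3 : ((m : ℝ) - n) * laguerreLin hα (laguerrePoly α m * laguerrePoly α n) = 0 := by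
    linear_combination h2
  rcases mul_eq_zero.1 h3 with h4 | h4
  · exact absurd (Nat.cast_injective (sub_eq_zero.1 h4)) h
  · exact h4

lemma derivative_laguerrePoly (α : ℝ) (n : ℕ) :
    derivative (laguerrePoly α n) = -∑ k ∈ Finset.range n, laguerrePoly α k := by
  induction n with
  | zero => simp [laguerrePoly]
  | succ n ih => rw [derivative_laguerrePoly_succ, ih, Finset.sum_range_succ]; ring

/-- The squared norm of `laguerrePoly α n`. -/
def laguerreH (α : ℝ) (n : ℕ) : ℝ := laguerreInt α (laguerrePoly α n * laguerrePoly α n)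

lemma laguerreH_zero {α : ℝ} (hα : -1 < α) : 0 < laguerreH α 0 := by
  have := laguerreInt_monomial hα 0 1
  rw [monomial_zero_one] at this
  rw [laguerreH, laguerrePoly, one_mul, this, one_mul]
  exact Real.Gamma_pos_of_pos (by simp; linarith)

lemma laguerreLin_mul_derivative_of_le {α : ℝ} (hα : -1 < α) {m n : ℕ} (h : n ≤ m) :
    laguerreLin hα (laguerrePoly α m * derivative (laguerrePoly α n)) = 0 := by
  rw [derivative_laguerrePoly, mul_neg, Finset.mul_sum, map_neg, map_sum, neg_eq_zero]
  refine Finset.sum_eq_zero fun k hk => laguerrePoly_orthogonal hα ?_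
  have := Finset.mem_range.1 hk; omega

lemma laguerreH_succ {α : ℝ} (hα : -1 < α) (n : ℕ) :
    (n + 1 : ℝ) * laguerreH α (n + 1) = (n + 1 + α) * laguerreH α n := by
  have h1 := laguerreLin_X_mul_derivative_mul hα (n + 1) (laguerrePoly α (n + 1))
  rw [X_mul_derivative_laguerrePoly, sub_mul, mul_assoc, mul_assoc, ← smul_eq_C_mul,
    ← smul_eq_C_mul, map_sub, map_smul, map_smul, laguerreLin_mul_derivative_of_le hα le_rfl,
    derivative_laguerrePoly_succ, mul_sub, map_sub, laguerreLin_mul_derivative_of_le hα le_rfl] at h1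
  change _ = _ * laguerreH α (n + 1) at h1
  push_cast at h1
  rw [← h1, smul_eq_mul, smul_eq_mul]
  change (n + 1 : ℝ) * 0 - (n + 1 + α) * (0 - laguerreH α n) = _
  ring

lemma laguerreH_pos {α : ℝ} (hα : -1 < α) (n : ℕ) : 0 < laguerreH α n := by
  induction n with
  | zero => exact laguerreH_zero hα
  | succ n ih =>
    have h := laguerreH_succ hα n
    have h1 : (0 : ℝ) < n + 1 := by positivity
    have h2 : (0 : ℝ) < n + 1 + α := by have : (0 : ℝ) ≤ n := n.cast_nonneg; linarith
    exact pos_of_mul_pos_right (h ▸ mul_pos h2 ih) h1.le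

lemma laguerreInt_sum_mul_self {α : ℝ} (hα : -1 < α) (a : ℕ → ℝ) (s : Finset ℕ) :
    laguerreInt α ((∑ k ∈ s, C (a k) * laguerrePoly α k) * ∑ k ∈ s, C (a k) * laguerrePoly α k)
      = ∑ k ∈ s, laguerreH α k * a k ^ 2 := by
  change laguerreLin hα _ = _
  rw [Finset.sum_mul_sum, map_sum]
  refine Finset.sum_congr rfl fun i hi => ?_
  rw [map_sum, Finset.sum_eq_single i]
  · rw [show C (a i) * laguerrePoly α i * (C (a i) * laguerrePoly α i)
      = (a i * a i) • (laguerrePoly α i * laguerrePoly α i) by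
        rw [smul_eq_C_mul, C_mul]; ring, map_smul]
    change (a i * a i) * laguerreH α i = _
    ring
  · intro j _ hj
    rw [show C (a i) * laguerrePoly α i * (C (a j) * laguerrePoly α j)
      = (a i * a j) • (laguerrePoly α i * laguerrePoly α j) by
        rw [smul_eq_C_mul, C_mul]; ring, map_smul, laguerrePoly_orthogonal hα hj.symm, smul_zero]
  · exact fun h => absurd hi h

lemma degree_laguerrePoly (α : ℝ) (n : ℕ) : (laguerrePoly α n).degree = n := by
  induction n with
  | zero => simp [laguerrePoly]
  | succ n ih =>
    have h1 : (derivative (laguerrePoly α (n + 1))).degree = n := by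
      rw [derivative_laguerrePoly_succ, ← ih]
      apply degree_sub_eq_right_of_degree_lt
      exact degree_derivative_lt (by rintro h; rw [h] at ih; simp at ih)
    have h2 : (derivative (laguerrePoly α (n + 1))).natDegree = n :=
      natDegree_eq_of_degree_eq_some h1
    have h3 : laguerrePoly α (n + 1) ≠ 0 := by rintro h; rw [h] at h1; simp at h1
    rw [natDegree_derivative] at h2
    have h5 : (laguerrePoly α (n + 1)).natDegree ≠ 0 := by
      intro h
      rw [natDegree_eq_zero] at h
      obtain ⟨c, hc⟩ := h
      rw [← hc] at h1; simp at h1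
    rw [degree_eq_natDegree h3]
    norm_cast
    omega

/-- Every polynomial of degree less than `n` is a combination of the first `n` Laguerre
polynomials. -/
lemma exists_laguerre_expansion (α : ℝ) (n : ℕ) (p : ℝ[X]) (hp : p.degree < n) :
    ∃ u : ℕ → ℝ, p = ∑ k ∈ Finset.range n, C (u k) * laguerrePoly α k := by
  induction n generalizing p with
  | zero =>
    refine ⟨0, ?_⟩
    simpa using hp
  | succ n ih =>
    set q := laguerrePoly α n with hq
    have hd : q.degree = n := degree_laguerrePoly α n
    have hnd : q.natDegree = n := natDegree_eq_of_degree_eq_some hd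
    have hlc : q.coeff n ≠ 0 := by
      rw [← hnd]; exact leadingCoeff_ne_zero.2 (by rintro h; rw [h] at hd; simp at hd)
    obtain ⟨u, hu⟩ := ih (p - C (p.coeff n / q.coeff n) * q) (by
      rw [degree_lt_iff_coeff_zero]
      intro m hm
      rcases hm.eq_or_lt with hm | hm
      · rw [← hm]
        rw [coeff_sub, coeff_C_mul, div_mul_cancel₀ _ hlc, sub_self]
      · rw [coeff_sub, coeff_C_mul,
          coeff_eq_zero_of_degree_lt (p := q) (n := m) (by rw [hd]; exact_mod_cast hm),
          coeff_eq_zero_of_degree_lt (lt_of_lt_of_le hp (by exact_mod_cast hm))]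
        simp)
    refine ⟨fun k => if k = n then p.coeff n / q.coeff n else u k, ?_⟩
    rw [Finset.sum_range_succ, ← hq, ← sub_eq_iff_eq_add]
    simp only [if_true]
    rw [hu]
    refine Finset.sum_congr rfl fun k hk => ?_
    rw [if_neg (Finset.mem_range.1 hk).ne]

/-! ### Reduction to a discrete Hardy inequality -/

/-- The polynomial with constant shift `c` and derivative `-∑ u_k L_k`. -/
def hardyPoly (α : ℝ) (n : ℕ) (c : ℝ) (u : ℕ → ℝ) : ℝ[X] :=
  C c + ∑ k ∈ Finset.range n, C (u k) * (laguerrePoly α (k + 1) - laguerrePoly α k)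

lemma derivative_hardyPoly (α : ℝ) (n : ℕ) (c : ℝ) (u : ℕ → ℝ) :
    derivative (hardyPoly α n c u) = ∑ k ∈ Finset.range n, C (-u k) * laguerrePoly α k := by
  rw [hardyPoly, derivative_add, derivative_C, zero_add, derivative_sum]
  refine Finset.sum_congr rfl fun k _ => ?_
  rw [derivative_C_mul, derivative_sub, derivative_laguerrePoly_succ, C_neg]
  ring

lemma hardyPoly_eq (α : ℝ) (n : ℕ) (c : ℝ) (u : ℕ → ℝ) :
    hardyPoly α n c u = C (c - u 0) * laguerrePoly α 0
      + ∑ k ∈ Finset.range n, C (u k - u (k + 1)) * laguerrePoly α (k + 1)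
      + C (u n) * laguerrePoly α n := by
  rw [hardyPoly]
  induction n with
  | zero => simp [laguerrePoly]
  | succ n ih =>
    rw [Finset.sum_range_succ, ← add_assoc, ih, Finset.sum_range_succ]
    simp only [C_sub]
    ring

lemma laguerreInt_derivative_hardyPoly {α : ℝ} (hα : -1 < α) (n : ℕ) (c : ℝ) (u : ℕ → ℝ) :
    laguerreInt α (derivative (hardyPoly α n c u) * derivative (hardyPoly α n c u)) =
      ∑ k ∈ Finset.range n, laguerreH α k * u k ^ 2 := by
  rw [derivative_hardyPoly, laguerreInt_sum_mul_self hα]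
  simp

lemma laguerreInt_hardyPoly {α : ℝ} (hα : -1 < α) (n : ℕ) (c : ℝ) (u : ℕ → ℝ) (hu : u n = 0) :
    laguerreInt α (hardyPoly α n c u * hardyPoly α n c u) =
      laguerreH α 0 * (c - u 0) ^ 2 +
        ∑ k ∈ Finset.range n, laguerreH α (k + 1) * (u k - u (k + 1)) ^ 2 := by
  have h : hardyPoly α n c u = ∑ k ∈ Finset.range (n + 1),
      C (Nat.casesOn k (c - u 0) fun j => u j - u (j + 1)) * laguerrePoly α k := by
    rw [hardyPoly_eq, hu, Finset.sum_range_succ']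
    simp [add_comm]
  rw [h, laguerreInt_sum_mul_self hα, Finset.sum_range_succ', add_comm]
  rfl

lemma exists_eq_hardyPoly (α : ℝ) (n : ℕ) (p : ℝ[X]) (hp : p.natDegree ≤ n) :
    ∃ c u, u n = 0 ∧ p = hardyPoly α n c u := by
  obtain ⟨u, hu⟩ := exists_laguerre_expansion α n (derivative p) (by
    rw [degree_lt_iff_coeff_zero]
    intro m hm
    rw [coeff_derivative, coeff_eq_zero_of_natDegree_lt (by omega), zero_mul])
  set v : ℕ → ℝ := fun k => if k = n then 0 else -u k with hv
  have hd : derivative (p - hardyPoly α n 0 v) = 0 := by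
    rw [derivative_sub, derivative_hardyPoly, hu, sub_eq_zero]
    refine Finset.sum_congr rfl fun k hk => ?_
    rw [hv]
    simp only [(Finset.mem_range.1 hk).ne, if_false, neg_neg]
  have h := eq_C_of_derivative_eq_zero hd
  refine ⟨(p - hardyPoly α n 0 v).coeff 0, v, by simp [hv], ?_⟩
  rw [sub_eq_iff_eq_add] at h
  refine h.trans ?_
  simp [hardyPoly]

/-- A discrete Hardy inequality bounds the Markov quotients. -/
lemma sq_le_of_hardy {n : ℕ} {α l : ℝ} (hα : -1 < α) (hl : 0 < l)
    (H : ∀ u : ℕ → ℝ, u n = 0 → l * ∑ k ∈ Finset.range n, laguerreH α k * u k ^ 2 ≤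
      ∑ k ∈ Finset.range n, laguerreH α (k + 1) * (u k - u (k + 1)) ^ 2)
    {r : ℝ} (hr : r ∈ markovQuotients n α) : r ^ 2 ≤ l⁻¹ := by
  obtain ⟨p, -, hp, rfl⟩ := hr
  obtain ⟨c, u, hu, rfl⟩ := exists_eq_hardyPoly α n p hp
  have hH := H u hu
  have h0 : 0 ≤ laguerreH α 0 * (c - u 0) ^ 2 :=
    mul_nonneg (laguerreH_pos hα 0).le (sq_nonneg _)
  have h1 : 0 ≤ ∑ k ∈ Finset.range n, laguerreH α k * u k ^ 2 :=
    Finset.sum_nonneg fun k _ => mul_nonneg (laguerreH_pos hα k).le (sq_nonneg _)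
  have h2 : 0 ≤ ∑ k ∈ Finset.range n, laguerreH α (k + 1) * (u k - u (k + 1)) ^ 2 :=
    Finset.sum_nonneg fun k _ => mul_nonneg (laguerreH_pos hα _).le (sq_nonneg _)
  rw [laguerreNorm_eq, laguerreNorm_eq, laguerreInt_derivative_hardyPoly hα,
    laguerreInt_hardyPoly hα n c u hu, div_pow, Real.sq_sqrt h1, Real.sq_sqrt (add_nonneg h0 h2)]
  apply div_le_of_le_mul₀ (add_nonneg h0 h2) (inv_nonneg.2 hl.le)
  rw [inv_mul_eq_div, le_div_iff₀ hl]
  linarith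

/-- An extremal sequence for the Hardy inequality gives a Markov quotient. -/
lemma sqrt_inv_mem_markovQuotients {n : ℕ} {α l : ℝ} (hα : -1 < α) (hl : 0 < l) (hn : n ≠ 0)
    {u : ℕ → ℝ} (hu : u n = 0) (hu0 : u 0 ≠ 0)
    (H : l * ∑ k ∈ Finset.range n, laguerreH α k * u k ^ 2 =
      ∑ k ∈ Finset.range n, laguerreH α (k + 1) * (u k - u (k + 1)) ^ 2) :
    √(l⁻¹) ∈ markovQuotients n α := by
  have h1 : 0 < ∑ k ∈ Finset.range n, laguerreH α k * u k ^ 2 :=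
    Finset.sum_pos' (fun k _ => mul_nonneg (laguerreH_pos hα k).le (sq_nonneg _))
      ⟨0, Finset.mem_range.2 (Nat.pos_of_ne_zero hn),
        mul_pos (laguerreH_pos hα 0) (by positivity)⟩
  have hd := laguerreInt_derivative_hardyPoly hα n (u 0) u
  refine ⟨hardyPoly α n (u 0) u, ?_, ?_, ?_⟩
  · intro h
    rw [h, derivative_zero, mul_zero] at hd
    have : laguerreInt α 0 = 0 := map_zero (laguerreLin hα)
    linarith
  · rw [hardyPoly]
    refine (natDegree_add_le _ _).trans (max_le (by simp) ?_)
    refine natDegree_sum_le_of_forall_le _ _ fun k hk => ?_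
    refine natDegree_C_mul_le _ _ |>.trans ((natDegree_sub_le _ _).trans ?_)
    rw [natDegree_eq_of_degree_eq_some (degree_laguerrePoly α _),
      natDegree_eq_of_degree_eq_some (degree_laguerrePoly α _)]
    have := Finset.mem_range.1 hk
    omega
  · rw [laguerreNorm_eq, laguerreNorm_eq, hd, laguerreInt_hardyPoly hα n _ u hu, sub_self,
      ← Real.sqrt_div h1.le, ← H]
    congr 1
    field_simp
    ring

lemma zero_mem_markovQuotients (n : ℕ) (α : ℝ) : 0 ∈ markovQuotients n α :=
  ⟨1, one_ne_zero, by simp, by simp [laguerreNorm]⟩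

lemma isLUB_markovConst {n : ℕ} {α l : ℝ} (hα : -1 < α) (hl : 0 < l)
    (H : ∀ u : ℕ → ℝ, u n = 0 → l * ∑ k ∈ Finset.range n, laguerreH α k * u k ^ 2 ≤
      ∑ k ∈ Finset.range n, laguerreH α (k + 1) * (u k - u (k + 1)) ^ 2) :
    IsLUB (markovQuotients n α) (markovConst n α) ∧ markovConst n α ^ 2 ≤ l⁻¹ := by
  have hub : √(l⁻¹) ∈ upperBounds (markovQuotients n α) := fun r hr =>
    Real.le_sqrt_of_sq_le (sq_le_of_hardy hα hl H hr)
  have h := isLUB_csSup ⟨0, zero_mem_markovQuotients n α⟩ ⟨_, hub⟩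
  refine ⟨h, ?_⟩
  have h0 : 0 ≤ markovConst n α := h.1 (zero_mem_markovQuotients n α)
  calc markovConst n α ^ 2 ≤ √(l⁻¹) ^ 2 := pow_le_pow_left₀ h0 (h.2 hub) 2
    _ = l⁻¹ := Real.sq_sqrt (inv_nonneg.2 hl.le)

/-! ### The characteristic polynomials of the discrete Hardy inequality -/

/-- The solution `S_n` of the discrete Sturm–Liouville equation with spectral parameter `X`,
together with its backward differences `S_{n-1} - S_n`. -/
def spectralPair (α : ℝ) : ℕ → ℝ[X] × ℝ[X]
  | 0 => (1, 0)
  | n + 1 =>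
    let d := C ((n + 1) / (n + 1 + α)) * ((spectralPair α n).2 + X * (spectralPair α n).1)
    ((spectralPair α n).1 - d, d)

/-- The solution of the discrete Sturm–Liouville equation with spectral parameter `X`. -/
def spectralPoly (α : ℝ) (n : ℕ) : ℝ[X] := (spectralPair α n).1

/-- The backward differences of `spectralPoly`. -/
def spectralDiff (α : ℝ) (n : ℕ) : ℝ[X] := (spectralPair α n).2

lemma spectralPoly_zero (α : ℝ) : spectralPoly α 0 = 1 := rfl

lemma spectralDiff_zero (α : ℝ) : spectralDiff α 0 = 0 := rfl

lemma spectralDiff_succ (α : ℝ) (n : ℕ) :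
    spectralDiff α (n + 1) =
      C ((n + 1) / (n + 1 + α)) * (spectralDiff α n + X * spectralPoly α n) := rfl

lemma spectralPoly_succ (α : ℝ) (n : ℕ) :
    spectralPoly α (n + 1) = spectralPoly α n - spectralDiff α (n + 1) := rfl

lemma laguerreH_mul_aeval_spectralDiff_succ {K : Type*} [RCLike K] {α : ℝ} (hα : -1 < α) (n : ℕ)
    (z : K) : (laguerreH α (n + 1) : K) * aeval z (spectralDiff α (n + 1)) =
      laguerreH α n * (aeval z (spectralDiff α n) + z * aeval z (spectralPoly α n)) := by
  have h2 : (0 : ℝ) < n + 1 + α := by have : (0 : ℝ) ≤ n := n.cast_nonneg; linarith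
  have h : laguerreH α (n + 1) * ((n + 1) / (n + 1 + α)) = laguerreH α n := by
    rw [mul_div_assoc', mul_comm, laguerreH_succ hα, mul_div_cancel_left₀ _ h2.ne']
  rw [spectralDiff_succ, map_mul, aeval_C, ← mul_assoc, map_add, map_mul, aeval_X,
    RCLike.algebraMap_eq_ofReal, ← RCLike.ofReal_mul, h]

/-- Summation by parts for the discrete Sturm–Liouville equation. -/
lemma sum_laguerreH_spectralDiff {K : Type*} [RCLike K] {α : ℝ} (hα : -1 < α) (n : ℕ) (z : K) :
    ∑ k ∈ Finset.range n, (laguerreH α (k + 1) : K) *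
      (aeval z (spectralDiff α (k + 1)) * starRingEnd K (aeval z (spectralDiff α (k + 1)))) =
    z * (∑ k ∈ Finset.range n, (laguerreH α k : K) *
      (aeval z (spectralPoly α k) * starRingEnd K (aeval z (spectralPoly α k)))) -
      laguerreH α n * aeval z (spectralDiff α n) * starRingEnd K (aeval z (spectralPoly α n)) := by
  induction n with
  | zero => simp [spectralDiff_zero]
  | succ n ih =>
    rw [Finset.sum_range_succ, ih, Finset.sum_range_succ]
    have h := laguerreH_mul_aeval_spectralDiff_succ hα n z
    have e : starRingEnd K (aeval z (spectralDiff α (n + 1))) =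
        starRingEnd K (aeval z (spectralPoly α n))
          - starRingEnd K (aeval z (spectralPoly α (n + 1))) := by
      rw [spectralPoly_succ, map_sub, map_sub, sub_sub_cancel]
    linear_combination (starRingEnd K (aeval z (spectralPoly α n))) * h +
      (laguerreH α (n + 1) : K) * aeval z (spectralDiff α (n + 1)) * e

lemma eval_zero_spectral (α : ℝ) (n : ℕ) :
    (spectralPoly α n).eval 0 = 1 ∧ (spectralDiff α n).eval 0 = 0 := by
  induction n with
  | zero => simp [spectralPoly_zero, spectralDiff_zero]
  | succ n ih => simp [spectralPoly_succ, spectralDiff_succ, ih]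

/-- The complex roots of `spectralPoly` are positive reals. -/
lemma exists_pos_of_aeval_spectralPoly_eq_zero {α : ℝ} (hα : -1 < α) (n : ℕ) (z : ℂ)
    (hz : aeval z (spectralPoly α n) = 0) : ∃ x : ℝ, 0 < x ∧ (x : ℂ) = z := by
  have hn : n ≠ 0 := by rintro rfl; simp [spectralPoly_zero] at hz
  have h := sum_laguerreH_spectralDiff hα n z
  rw [hz, map_zero, mul_zero, sub_zero] at h
  simp only [RCLike.mul_conj] at h
  set A := ∑ k ∈ Finset.range n, laguerreH α (k + 1) * ‖aeval z (spectralDiff α (k + 1))‖ ^ 2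
    with hA
  set B := ∑ k ∈ Finset.range n, laguerreH α k * ‖aeval z (spectralPoly α k)‖ ^ 2 with hB
  have h' : (A : ℂ) = z * B := by
    rw [hA, hB]
    push_cast
    exact h
  have hB0 : 0 < B :=
    Finset.sum_pos' (fun k _ => mul_nonneg (laguerreH_pos hα k).le (sq_nonneg _))
      ⟨0, Finset.mem_range.2 (Nat.pos_of_ne_zero hn), by
        simpa [spectralPoly_zero] using laguerreH_pos hα 0⟩
  have hA0 : 0 ≤ A :=
    Finset.sum_nonneg fun k _ => mul_nonneg (laguerreH_pos hα _).le (sq_nonneg _)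
  have hzx : ((A / B : ℝ) : ℂ) = z := by
    have : (B : ℂ) ≠ 0 := by exact_mod_cast hB0.ne'
    push_cast
    rw [h', mul_div_cancel_right₀ _ this]
  refine ⟨A / B, lt_of_le_of_ne (div_nonneg hA0 hB0.le) fun h0 => ?_, hzx⟩
  rw [← h0, Complex.ofReal_zero] at hzx
  rw [← hzx, ← Complex.ofReal_zero, ← Complex.coe_algebraMap, aeval_algebraMap_apply,
    coe_aeval_eq_eval, (eval_zero_spectral α n).1] at hz
  simp at hz

/-- A real polynomial with constant term `1` all of whose complex roots are positive reals is a
product of factors `1 - μ X` with `μ > 0`. -/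
lemma exists_multiset_prod_one_sub (d : ℕ) (p : ℝ[X]) (hd : p.natDegree ≤ d) (h0 : p.eval 0 = 1)
    (hp : ∀ z : ℂ, aeval z p = 0 → ∃ x : ℝ, 0 < x ∧ (x : ℂ) = z) :
    ∃ m : Multiset ℝ, (∀ μ ∈ m, 0 < μ) ∧ p = (m.map fun μ => 1 - C μ * X).prod := by
  induction d generalizing p with
  | zero =>
    refine ⟨0, by simp, ?_⟩
    rw [eq_C_of_natDegree_le_zero hd, ← coeff_zero_eq_eval_zero] at *
    simp at h0 ⊢
    rw [h0, C_1]
  | succ d ih =>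
    by_cases hd' : p.natDegree = 0
    · exact ih p (by omega) h0 hp
    obtain ⟨z, hz⟩ := IsAlgClosed.exists_aeval_eq_zero ℂ p
      (fun h => hd' (natDegree_eq_of_degree_eq_some h))
    obtain ⟨x, hx, rfl⟩ := hp z hz
    have hroot : p.IsRoot x := by
      rw [← Complex.coe_algebraMap, aeval_algebraMap_apply, coe_aeval_eq_eval] at hz
      simpa using hz
    obtain ⟨q, hq⟩ := dvd_iff_isRoot.2 hroot
    have hq' : p = (1 - C x⁻¹ * X) * (C (-x) * q) := by
      have : C x⁻¹ * C x = (1 : ℝ[X]) := by rw [← C_mul, inv_mul_cancel₀ hx.ne', C_1]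
      rw [hq, C_neg]
      linear_combination (-X * q) * this
    have hp0 : p ≠ 0 := by rintro rfl; simp at h0
    obtain ⟨m, hm, hm'⟩ := ih (C (-x) * q) (by
        have hq0 : q ≠ 0 := by rintro rfl; simp at hq; exact hp0 hq
        have := natDegree_mul (X_sub_C_ne_zero x) hq0
        rw [← hq, natDegree_X_sub_C] at this
        exact (natDegree_C_mul_le _ _).trans (by omega)) (by
        rw [hq'] at h0
        simpa using h0) (fun z hz => hp z (by rw [hq', map_mul, hz, mul_zero]))
    refine ⟨x⁻¹ ::ₘ m, ?_, ?_⟩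
    · intro μ hμ
      rcases Multiset.mem_cons.1 hμ with rfl | h
      · positivity
      · exact hm μ h
    · rw [Multiset.map_cons, Multiset.prod_cons, ← hm', ← hq']

lemma exists_spectralPoly_eq_prod {α : ℝ} (hα : -1 < α) (n : ℕ) :
    ∃ m : Multiset ℝ, (∀ μ ∈ m, 0 < μ) ∧
      spectralPoly α n = (m.map fun μ => 1 - C μ * X).prod :=
  exists_multiset_prod_one_sub _ _ le_rfl (eval_zero_spectral α n).1
    (exists_pos_of_aeval_spectralPoly_eq_zero hα n)

lemma laguerreH_mul_eval_spectralDiff_succ {α : ℝ} (hα : -1 < α) (n : ℕ) (t : ℝ) :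
    laguerreH α (n + 1) * (spectralDiff α (n + 1)).eval t =
      laguerreH α n * ((spectralDiff α n).eval t + t * (spectralPoly α n).eval t) := by
  simpa using laguerreH_mul_aeval_spectralDiff_succ hα n t

lemma eval_spectralDiff_nonneg {α t : ℝ} (hα : -1 < α) (ht : 0 ≤ t) {n : ℕ}
    (h : ∀ j < n, 0 ≤ (spectralPoly α j).eval t) : 0 ≤ (spectralDiff α n).eval t := by
  induction n with
  | zero => simp [spectralDiff_zero]
  | succ n ih =>
    have h1 := laguerreH_mul_eval_spectralDiff_succ hα n t
    have h2 := ih fun j hj => h j (by omega)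
    refine nonneg_of_mul_nonneg_right (a := laguerreH α (n + 1)) ?_ (laguerreH_pos hα _)
    rw [h1]
    exact mul_nonneg (laguerreH_pos hα _).le (add_nonneg h2 (mul_nonneg ht (h n (by omega))))

lemma eval_spectralPoly_anti {α t : ℝ} (hα : -1 < α) (ht : 0 ≤ t) {n : ℕ}
    (h : ∀ j ≤ n, 0 ≤ (spectralPoly α j).eval t) {j : ℕ} (hj : j ≤ n) :
    (spectralPoly α n).eval t ≤ (spectralPoly α j).eval t := by
  induction n with
  | zero => rw [Nat.le_zero.1 hj]
  | succ n ih =>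
    rcases hj.eq_or_lt with rfl | hj
    · exact le_rfl
    refine le_trans ?_ (ih (fun j hj => h j (by omega)) (by omega))
    rw [spectralPoly_succ, eval_sub]
    linarith [eval_spectralDiff_nonneg hα ht (n := n + 1) fun j hj => h j (by omega)]

/-- If `S_n` is positive on `[0, T]` then so are all the previous `S_j`. -/
lemma eval_spectralPoly_pos {α T : ℝ} (hα : -1 < α) (hT : 0 ≤ T) {n : ℕ}
    (h : ∀ t ∈ Set.Icc 0 T, 0 < (spectralPoly α n).eval t) :
    ∀ j ≤ n, 0 < (spectralPoly α j).eval T := by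
  set K : Set ℝ := {t | ∀ j ≤ n, 0 ≤ (spectralPoly α j).eval t} with hK
  have hKpos : ∀ t ∈ Set.Icc 0 T, t ∈ K → ∀ j ≤ n, 0 < (spectralPoly α j).eval t :=
    fun t ht htK j hj => (h t ht).trans_le (eval_spectralPoly_anti hα ht.1 htK hj)
  have hclosed : IsClosed K := by
    simp only [hK, Set.ofPred_forall]
    exact isClosed_iInter fun j => isClosed_iInter fun _ =>
      isClosed_le continuous_const (spectralPoly α j).continuous
  have hsub : Set.Icc 0 T ⊆ K := by
    refine IsClosed.Icc_subset_of_forall_mem_nhdsWithin (hclosed.inter isClosed_Icc) ?_ ?_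
    · intro j _
      rw [(eval_zero_spectral α j).1]
      exact zero_le_one
    · rintro t ⟨htK, ht⟩
      have hp := hKpos t ⟨ht.1, ht.2.le⟩ htK
      apply mem_nhdsWithin_of_mem_nhds
      have : ∀ᶠ s in 𝓝 t, ∀ j ∈ Finset.range (n + 1), 0 < (spectralPoly α j).eval s :=
        (Finset.eventually_all _).2 fun j hj =>
          (spectralPoly α j).continuous.continuousAt.eventually
            (lt_mem_nhds (hp j (by have := Finset.mem_range.1 hj; omega)))
      filter_upwards [this] with s hs j hj
      exact (hs j (Finset.mem_range.2 (by omega))).le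
  exact hKpos T ⟨hT, le_rfl⟩ (hsub ⟨hT, le_rfl⟩)

/-- The Riccati form of Picone's inequality: a nonnegative supersolution of the discrete Riccati
equation gives a discrete Hardy inequality. -/
lemma hardy_of_riccati {α l : ℝ} (hα : -1 < α) {n : ℕ} {ρ : ℕ → ℝ} (h0 : 0 ≤ ρ 0)
    (hρ : ∀ k < n, ∀ x y : ℝ, laguerreH α k * (l + ρ k) * x ^ 2 ≤
      laguerreH α (k + 1) * ((x - y) ^ 2 + ρ (k + 1) * y ^ 2))
    {u : ℕ → ℝ} (hu : u n = 0) :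
    l * ∑ k ∈ Finset.range n, laguerreH α k * u k ^ 2 ≤
      ∑ k ∈ Finset.range n, laguerreH α (k + 1) * (u k - u (k + 1)) ^ 2 := by
  have key : ∀ N ≤ n, l * ∑ k ∈ Finset.range N, laguerreH α k * u k ^ 2 ≤
      ∑ k ∈ Finset.range N, laguerreH α (k + 1) * (u k - u (k + 1)) ^ 2
        + laguerreH α N * ρ N * u N ^ 2 := by
    intro N hN
    induction N with
    | zero =>
      simpa using mul_nonneg (mul_nonneg (laguerreH_pos hα 0).le h0) (sq_nonneg (u 0))
    | succ N ih =>
      have h1 := ih (by omega)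
      have h2 := hρ N (by omega) (u N) (u (N + 1))
      rw [Finset.sum_range_succ, Finset.sum_range_succ]
      linarith
  simpa [hu] using key n le_rfl

lemma hardy_of_eval_spectralPoly_pos {α t : ℝ} (hα : -1 < α) {n : ℕ}
    (h : ∀ j ≤ n, 0 < (spectralPoly α j).eval t) {u : ℕ → ℝ} (hu : u n = 0) :
    t * ∑ k ∈ Finset.range n, laguerreH α k * u k ^ 2 ≤
      ∑ k ∈ Finset.range n, laguerreH α (k + 1) * (u k - u (k + 1)) ^ 2 := by
  refine hardy_of_riccati hα
    (ρ := fun k => (spectralDiff α k).eval t / (spectralPoly α k).eval t) (by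
      simp [spectralDiff_zero]) (fun k hk x y => ?_) hu
  have ha := h k (by omega)
  have hb := h (k + 1) (by omega)
  have hd := laguerreH_mul_eval_spectralDiff_succ hα k t
  have hs : (spectralPoly α (k + 1)).eval t =
      (spectralPoly α k).eval t - (spectralDiff α (k + 1)).eval t := by
    rw [spectralPoly_succ, eval_sub]
  generalize (spectralPoly α k).eval t = a at *
  generalize (spectralPoly α (k + 1)).eval t = b at *
  generalize (spectralDiff α k).eval t = c at *
  generalize (spectralDiff α (k + 1)).eval t = d at *
  have hH := laguerreH_pos hα (k + 1)
  generalize laguerreH α (k + 1) = H at *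
  generalize laguerreH α k = H' at *
  have e1 : H' * (t + c / a) * x ^ 2 = H * d / a * x ^ 2 := by
    rw [hd]; field_simp; ring
  obtain rfl : d = a - b := by linarith
  have e2 : H * ((x - y) ^ 2 + (a - b) / b * y ^ 2) - H * (a - b) / a * x ^ 2
      = H * (b * x - a * y) ^ 2 / (a * b) := by
    field_simp; ring
  have : 0 ≤ H * (b * x - a * y) ^ 2 / (a * b) := by positivity
  rw [e1]
  linarith

lemma eval_prod_one_sub (m : Multiset ℝ) (t : ℝ) :
    ((m.map fun μ => 1 - C μ * X).prod).eval t = (m.map fun μ => 1 - μ * t).prod := by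
  rw [eval_multiset_prod, Multiset.map_map]
  simp

/-- The spectral description of the Markov constant. -/
theorem exists_markov_spectrum {α : ℝ} (hα : -1 < α) (n : ℕ) :
    IsLUB (markovQuotients n α) (markovConst n α) ∧
    ∃ m : Multiset ℝ, (∀ μ ∈ m, 0 < μ ∧ μ ≤ markovConst n α ^ 2) ∧
      (m ≠ 0 → markovConst n α ^ 2 ∈ m) ∧
      spectralPoly α n = (m.map fun μ => 1 - C μ * X).prod := by
  obtain ⟨m, hm, hprod⟩ := exists_spectralPoly_eq_prod hα n
  have hardy : ∀ t > 0, (∀ μ ∈ m, μ * t < 1) →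
      IsLUB (markovQuotients n α) (markovConst n α) ∧ markovConst n α ^ 2 ≤ t⁻¹ := by
    intro t ht hmt
    refine isLUB_markovConst hα ht fun u hu =>
      hardy_of_eval_spectralPoly_pos hα (eval_spectralPoly_pos hα ht.le ?_) hu
    intro s hs
    rw [hprod, eval_prod_one_sub]
    refine Multiset.prod_pos ?_
    intro y hy
    obtain ⟨μ, hμ, rfl⟩ := Multiset.mem_map.1 hy
    have := mul_le_mul_of_nonneg_left hs.2 (hm μ hμ).le
    linarith [hmt μ hμ]
  by_cases hm0 : m = 0
  · subst hm0
    exact ⟨(hardy 1 one_pos (by simp)).1, 0, by simp, by simp, hprod⟩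
  obtain ⟨M, hM, hmax⟩ := m.toFinset.exists_max_image id (by simpa using hm0)
  simp only [Multiset.mem_toFinset, id] at hM hmax
  have hM0 := hm M hM
  have hlub : IsLUB (markovQuotients n α) (markovConst n α) := by
    refine (hardy (2 * M)⁻¹ (by positivity) fun μ hμ => ?_).1
    rw [← div_eq_mul_inv, div_lt_one (by positivity)]
    linarith [hmax μ hμ]
  have hle : markovConst n α ^ 2 ≤ M := by
    by_contra! hlt
    obtain ⟨s, hs1, hs2⟩ := exists_between hlt
    have hs0 : 0 < s := hM0.trans hs1
    have := (hardy s⁻¹ (by positivity) fun μ hμ => by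
      rw [← div_eq_mul_inv, div_lt_one hs0]
      linarith [hmax μ hμ]).2
    rw [inv_inv] at this
    linarith
  have hge : M ≤ markovConst n α ^ 2 := by
    have hroot : (spectralPoly α n).eval M⁻¹ = 0 := by
      rw [hprod, eval_prod_one_sub]
      refine Multiset.prod_eq_zero (Multiset.mem_map.2 ⟨M, hM, ?_⟩)
      rw [mul_inv_cancel₀ hM0.ne', sub_self]
    have hn : n ≠ 0 := by rintro rfl; simp [spectralPoly_zero] at hroot
    have hmem := sqrt_inv_mem_markovQuotients hα (l := M⁻¹) (by positivity) hn
      (u := fun k => (spectralPoly α k).eval M⁻¹) hroot (by simp [spectralPoly_zero]) (by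
        have := sum_laguerreH_spectralDiff hα n M⁻¹
        simp only [coe_aeval_eq_eval, hroot, conj_trivial, mul_zero, sub_zero,
          RCLike.ofReal_real_eq_id, id] at this
        simp only [pow_two]
        rw [← this]
        refine Finset.sum_congr rfl fun k _ => ?_
        rw [spectralPoly_succ, eval_sub, sub_sub_cancel])
    have h1 := hlub.1 hmem
    rw [inv_inv] at h1
    calc M = √M ^ 2 := (Real.sq_sqrt hM0.le).symm
      _ ≤ _ := pow_le_pow_left₀ (Real.sqrt_nonneg _) h1 2
  have heq := le_antisymm hle hge
  exact ⟨hlub, m, fun μ hμ => ⟨hm μ hμ, heq ▸ hmax μ hμ⟩, fun _ => heq ▸ hM, hprod⟩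

/-! ### Asymptotics of the coefficients -/

lemma cast_descFactorial_succ (n r : ℕ) :
    (n.descFactorial (r + 1) : ℝ) = (n - r) * n.descFactorial r := by
  rcases le_or_gt r n with h | h
  · rw [Nat.descFactorial_succ, Nat.cast_mul, Nat.cast_sub h]
  · rw [Nat.descFactorial_of_lt h, Nat.descFactorial_of_lt (by omega)]
    simp

lemma tendsto_descFactorial_div_pow (r : ℕ) :
    Tendsto (fun n : ℕ => (n.descFactorial r : ℝ) / (n : ℝ) ^ r) atTop (𝓝 1) := by
  induction r with
  | zero => simp
  | succ r ih =>
    have h1 : Tendsto (fun n : ℕ => 1 - (r : ℝ) / (n : ℝ)) atTop (𝓝 (1 - 0)) :=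
      tendsto_const_nhds.sub (tendsto_const_div_atTop_nhds_zero_nat _)
    have h2 := h1.mul ih
    rw [sub_zero, one_mul] at h2
    refine h2.congr' ?_
    filter_upwards [eventually_gt_atTop 0] with n hn
    have : (n : ℝ) ≠ 0 := by positivity
    rw [cast_descFactorial_succ]
    field_simp
    ring

lemma tendsto_descFactorial_div_pow_of_lt {r d : ℕ} (h : r < d) :
    Tendsto (fun n : ℕ => (n.descFactorial r : ℝ) / (n : ℝ) ^ d) atTop (𝓝 0) := by
  have h1 : Tendsto (fun n : ℕ => ((n : ℝ) ^ (d - r))⁻¹) atTop (𝓝 0) :=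
    tendsto_inv_atTop_zero.comp
      ((tendsto_pow_atTop (by omega)).comp tendsto_natCast_atTop_atTop)
  have h2 := (tendsto_descFactorial_div_pow r).mul h1
  rw [mul_zero] at h2
  refine h2.congr fun n => ?_
  rw [← div_eq_mul_inv, div_div, ← pow_add]
  congr 2
  omega

/-- The limits of the normalised coefficients of `spectralPoly`. -/
def spectralLimit (α : ℝ) : ℕ → ℝ
  | 0 => 1
  | k + 1 => -spectralLimit α k / ((2 * k + 2) * (2 * k + 1 + α))

lemma coeff_spectralDiff_succ (α : ℝ) (n k : ℕ) :
    (spectralDiff α (n + 1)).coeff (k + 1) = (n + 1) / (n + 1 + α) *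
      ((spectralDiff α n).coeff (k + 1) + (spectralPoly α n).coeff k) := by
  rw [spectralDiff_succ, coeff_C_mul, coeff_add, coeff_X_mul]

/-- The coefficients of `spectralPoly` are polynomials in the index. -/
lemma exists_coeff_spectralPoly_eq {α : ℝ} (hα : -1 < α) (k : ℕ) :
    ∃ c : ℕ → ℝ, (∀ r > 2 * k, c r = 0) ∧ c (2 * k) = spectralLimit α k ∧
      ∀ n, (spectralPoly α n).coeff k =
        ∑ r ∈ Finset.range (2 * k + 1), c r * n.descFactorial r := by
  induction k with
  | zero =>
    refine ⟨fun r => if r = 0 then 1 else 0, fun r hr => if_neg (by omega), rfl, fun n => ?_⟩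
    simp [coeff_zero_eq_eval_zero, (eval_zero_spectral α n).1]
  | succ k ih =>
    obtain ⟨c, hc0, hck, hc⟩ := ih
    have hpos : ∀ r : ℕ, 0 < α + r + 1 := fun r => by
      have : (0 : ℝ) ≤ r := r.cast_nonneg
      linarith
    have hE : ∀ n, (spectralDiff α n).coeff (k + 1) =
        ∑ r ∈ Finset.range (2 * k + 1), c r / (α + r + 1) * n.descFactorial (r + 1) := by
      intro n
      induction n with
      | zero => simp [spectralDiff_zero]
      | succ n ihn =>
        rw [coeff_spectralDiff_succ, ihn, hc, ← Finset.sum_add_distrib, Finset.mul_sum]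
        refine Finset.sum_congr rfl fun r _ => ?_
        rw [Nat.succ_descFactorial_succ, Nat.cast_mul, cast_descFactorial_succ]
        have h1 := hpos r
        have h2 := hpos n
        have h3 : (n : ℝ) + 1 + α ≠ 0 := by linarith
        push_cast
        field_simp
        ring
    set b : ℕ → ℝ := fun r => -(c r / ((r + 2) * (α + r + 1))) with hb
    have hF : ∀ n, (spectralPoly α n).coeff (k + 1) =
        ∑ r ∈ Finset.range (2 * k + 1),
          b r * (n.descFactorial (r + 2) + (r + 2) * n.descFactorial (r + 1)) := by
      intro n
      induction n with
      | zero => simp [spectralPoly_zero, coeff_one]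
      | succ n ihn =>
        rw [spectralPoly_succ, coeff_sub, ihn, hE, ← Finset.sum_sub_distrib]
        refine Finset.sum_congr rfl fun r _ => ?_
        rw [hb]
        have h1 := hpos r
        rw [Nat.succ_descFactorial_succ, Nat.succ_descFactorial_succ]
        push_cast
        rw [cast_descFactorial_succ n (r + 1)]
        have h4 := cast_descFactorial_succ n r
        push_cast
        rw [h4]
        field_simp
        ring
    refine ⟨fun s => Nat.casesOn s 0 fun s => Nat.casesOn s (2 * b 0) fun s =>
      b s + (s + 3) * b (s + 1), ?_, ?_, ?_⟩
    · intro r hr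
      obtain ⟨s, rfl⟩ : ∃ s, r = s + 2 := ⟨r - 2, by omega⟩
      simp [hb, hc0 s (by omega), hc0 (s + 1) (by omega)]
    · change b (2 * k) + _ * b (2 * k + 1) = _
      simp only [hb, hc0 (2 * k + 1) (by omega), hck, spectralLimit]
      push_cast
      rw [zero_div, neg_zero, mul_zero, add_zero, neg_div,
        show α + 2 * (k : ℝ) + 1 = 2 * k + 1 + α by ring]
    · intro n
      rw [hF, show 2 * (k + 1) + 1 = 2 * k + 1 + 1 + 1 by ring,
        Finset.sum_range_succ' _ (2 * k + 1 + 1), Finset.sum_range_succ' _ (2 * k + 1)]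
      have e1 : ∑ r ∈ Finset.range (2 * k + 1), b r * ((r + 2) * (n.descFactorial (r + 1) : ℝ))
          = ∑ r ∈ Finset.range (2 * k + 1), (r + 3) * b (r + 1) * (n.descFactorial (r + 2) : ℝ)
            + 2 * b 0 * n.descFactorial 1 := by
        rw [← add_zero (∑ r ∈ Finset.range (2 * k + 1), b r * _)]
        have : (0 : ℝ) = b (2 * k + 1) * (((2 * k + 1 : ℕ) + 2) *
          (n.descFactorial (2 * k + 1 + 1) : ℝ)) := by
          simp [hb, hc0 (2 * k + 1) (by omega)]
        rw [this, ← Finset.sum_range_succ (fun r : ℕ => b r * ((r + 2) *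
          (n.descFactorial (r + 1) : ℝ))), Finset.sum_range_succ']
        congr 1
        · refine Finset.sum_congr rfl fun r _ => ?_
          push_cast; ring
        · push_cast; ring
      change _ = ∑ r ∈ Finset.range (2 * k + 1),
        (b r + (r + 3) * b (r + 1)) * (n.descFactorial (r + 2) : ℝ) +
          2 * b 0 * n.descFactorial 1 + 0 * n.descFactorial 0
      simp only [mul_add (b _), add_mul (b _), Finset.sum_add_distrib, e1]
      ring

lemma tendsto_coeff_spectralPoly {α : ℝ} (hα : -1 < α) (k : ℕ) :
    Tendsto (fun n : ℕ => (spectralPoly α n).coeff k / ((n : ℝ) ^ 2) ^ k) atTop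
      (𝓝 (spectralLimit α k)) := by
  obtain ⟨c, -, hck, hc⟩ := exists_coeff_spectralPoly_eq hα k
  simp only [hc, ← pow_mul, Finset.sum_div, mul_div_assoc]
  have h : ∀ r ∈ Finset.range (2 * k + 1), Tendsto
      (fun n : ℕ => c r * ((n.descFactorial r : ℝ) / (n : ℝ) ^ (2 * k))) atTop
      (𝓝 (if r = 2 * k then c r else 0)) := by
    intro r hr
    split_ifs with h
    · subst h
      simpa using (tendsto_descFactorial_div_pow (2 * k)).const_mul (c (2 * k))
    · have := Finset.mem_range.1 hr
      simpa using (tendsto_descFactorial_div_pow_of_lt (r := r) (d := 2 * k)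
        (by omega)).const_mul (c r)
  have := tendsto_finsetSum _ h
  rwa [Finset.sum_ite_eq' , if_pos (by simp), hck] at this

/-! ### Power sums -/

/-- The power sums of a multiset. -/
def powerSum (m : Multiset ℝ) (k : ℕ) : ℝ := (m.map (· ^ k)).sum

lemma powerSum_cons (μ : ℝ) (m : Multiset ℝ) (k : ℕ) :
    powerSum (μ ::ₘ m) k = μ ^ k + powerSum m k := by
  simp [powerSum]

lemma derivative_prod_one_sub (m : Multiset ℝ) :
    ((derivative (m.map fun μ => 1 - C μ * X).prod : ℝ[X]) : PowerSeries ℝ) =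
      -((m.map fun μ => 1 - C μ * X).prod : ℝ[X]) *
        PowerSeries.mk fun k => powerSum m (k + 1) := by
  induction m using Multiset.induction_on with
  | empty => ext; simp [powerSum]
  | cons μ m ih =>
    rw [Multiset.map_cons, Multiset.prod_cons, derivative_mul]
    set P := (m.map fun μ => 1 - C μ * X).prod
    have hmk : (PowerSeries.mk fun k => powerSum (μ ::ₘ m) (k + 1)) =
        (PowerSeries.mk fun k => μ ^ (k + 1)) + PowerSeries.mk fun k => powerSum m (k + 1) := by
      ext k
      simp [powerSum_cons]
    have hgeo : (1 - PowerSeries.C μ * PowerSeries.X) * (PowerSeries.mk fun k => μ ^ (k + 1)) =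
        PowerSeries.C μ := by
      ext k
      rw [sub_mul, one_mul, map_sub, PowerSeries.coeff_mk, mul_assoc, PowerSeries.coeff_C_mul]
      cases k with
      | zero => simp
      | succ k =>
        rw [PowerSeries.coeff_succ_X_mul, PowerSeries.coeff_mk, PowerSeries.coeff_C,
          if_neg (by omega)]
        ring
    rw [hmk]
    simp only [derivative_sub, derivative_one, derivative_C_mul, derivative_X, mul_one, zero_sub,
      Polynomial.coe_add, Polynomial.coe_mul, Polynomial.coe_neg, Polynomial.coe_sub,
      Polynomial.coe_one, Polynomial.coe_C, Polynomial.coe_X, ih]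
    linear_combination (P : PowerSeries ℝ) * hgeo

/-- Newton's identities. -/
lemma powerSum_succ_eq {m : Multiset ℝ} {p : ℝ[X]}
    (hp : p = (m.map fun μ => 1 - C μ * X).prod) (k : ℕ) :
    powerSum m (k + 1) = -(k + 1) * p.coeff (k + 1) -
      ∑ i ∈ Finset.range k, p.coeff (i + 1) * powerSum m (k - i) := by
  have h := congrArg (PowerSeries.coeff k) (derivative_prod_one_sub m)
  have h0 : p.coeff 0 = 1 := by
    rw [hp, coeff_zero_eq_eval_zero, eval_prod_one_sub]; simp
  rw [← hp, Polynomial.coeff_coe, coeff_derivative, neg_mul, map_neg, PowerSeries.coeff_mul,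
    Finset.Nat.sum_antidiagonal_eq_sum_range_succ_mk, Finset.sum_range_succ'] at h
  simp only [Polynomial.coeff_coe, PowerSeries.coeff_mk, h0, Nat.sub_zero, one_mul] at h
  have e : ∑ i ∈ Finset.range k, p.coeff (i + 1) * powerSum m (k - (i + 1) + 1) =
      ∑ i ∈ Finset.range k, p.coeff (i + 1) * powerSum m (k - i) := by
    refine Finset.sum_congr rfl fun i hi => ?_
    have := Finset.mem_range.1 hi
    rw [show k - (i + 1) + 1 = k - i by omega]
  rw [e] at h
  linarith

lemma powerSum_map_div (m : Multiset ℝ) (a : ℝ) (k : ℕ) :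
    powerSum (m.map (· / a)) k = powerSum m k / a ^ k := by
  simp only [powerSum, Multiset.map_map, Function.comp_def, div_pow, Multiset.sum_map_div]

/-- Convergence of the normalised power sums. -/
lemma exists_tendsto_powerSum {α : ℝ} (hα : -1 < α) {m : ℕ → Multiset ℝ}
    (hm : ∀ n, spectralPoly α n = ((m n).map fun μ => 1 - C μ * X).prod) :
    ∃ σ : ℕ → ℝ,
      (∀ k, Tendsto (fun n : ℕ => powerSum ((m n).map (· / (n : ℝ) ^ 2)) (k + 1)) atTop
        (𝓝 (σ (k + 1)))) ∧
      ∀ k : ℕ, σ (k + 1) = -(k + 1) * spectralLimit α (k + 1) -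
        ∑ i ∈ Finset.range k, spectralLimit α (i + 1) * σ (k - i) := by
  have hrec : ∀ k : ℕ, (fun n : ℕ => powerSum ((m n).map (· / (n : ℝ) ^ 2)) (k + 1)) =
      fun n => -(k + 1) * ((spectralPoly α n).coeff (k + 1) / ((n : ℝ) ^ 2) ^ (k + 1)) -
        ∑ i ∈ Finset.range k, ((spectralPoly α n).coeff (i + 1) / ((n : ℝ) ^ 2) ^ (i + 1)) *
          powerSum ((m n).map (· / (n : ℝ) ^ 2)) (k - i) := by
    intro k
    funext n
    rw [powerSum_map_div, powerSum_succ_eq (hm n) k, sub_div, mul_div_assoc, Finset.sum_div]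
    congr 1
    refine Finset.sum_congr rfl fun i hi => ?_
    have := Finset.mem_range.1 hi
    rw [powerSum_map_div, div_mul_div_comm, ← pow_add, show i + 1 + (k - i) = k + 1 by omega]
  have hex : ∀ k, ∃ s, Tendsto (fun n : ℕ => powerSum ((m n).map (· / (n : ℝ) ^ 2)) (k + 1))
      atTop (𝓝 s) := by
    intro k
    induction k using Nat.strong_induction_on with
    | _ k ih =>
      have h : ∀ i, ∃ s, i ∈ Finset.range k → Tendsto
          (fun n : ℕ => powerSum ((m n).map (· / (n : ℝ) ^ 2)) (k - i)) atTop (𝓝 s) := by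
        intro i
        by_cases hi : i < k
        · obtain ⟨s, hs⟩ := ih (k - i - 1) (by omega)
          rw [show k - i - 1 + 1 = k - i by omega] at hs
          exact ⟨s, fun _ => hs⟩
        · exact ⟨0, fun h => absurd (Finset.mem_range.1 h) hi⟩
      choose s hs using h
      rw [hrec]
      exact ⟨_, ((tendsto_coeff_spectralPoly hα (k + 1)).const_mul _).sub
        (tendsto_finsetSum _ fun i hi => (tendsto_coeff_spectralPoly hα (i + 1)).mul (hs i hi))⟩
  choose s hs using hex
  refine ⟨fun k => s (k - 1), hs, fun k => ?_⟩
  refine tendsto_nhds_unique (hs k) ?_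
  rw [hrec]
  refine ((tendsto_coeff_spectralPoly hα (k + 1)).const_mul _).sub
    (tendsto_finsetSum _ fun i hi => (tendsto_coeff_spectralPoly hα (i + 1)).mul ?_)
  have := Finset.mem_range.1 hi
  have h := hs (k - i - 1)
  rwa [show k - i - 1 + 1 = k - i by omega] at h

/-! ### The limit of the largest eigenvalue -/

lemma powerSum_succ_le {m : Multiset ℝ} {x : ℝ} (hm : ∀ μ ∈ m, 0 < μ ∧ μ ≤ x) (k : ℕ) :
    powerSum m (k + 1) ≤ x * powerSum m k := by
  rw [powerSum, powerSum, ← Multiset.sum_map_mul_left]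
  refine Multiset.sum_map_le_sum_map _ _ fun μ hμ => ?_
  rw [pow_succ, mul_comm]
  exact mul_le_mul_of_nonneg_right (hm μ hμ).2 (pow_nonneg (hm μ hμ).1.le k)

lemma pow_le_powerSum {m : Multiset ℝ} {x : ℝ} (hm : ∀ μ ∈ m, 0 < μ) (hx : x ∈ m) (k : ℕ) :
    x ^ k ≤ powerSum m k := by
  refine Multiset.single_le_sum ?_ _ (Multiset.mem_map_of_mem _ hx)
  intro y hy
  obtain ⟨μ, hμ, rfl⟩ := Multiset.mem_map.1 hy
  exact pow_nonneg (hm μ hμ).le k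

lemma powerSum_quadratic_nonneg (m : Multiset ℝ) (θ : ℝ) :
    0 ≤ powerSum m 6 - 2 * θ * powerSum m 5 + θ ^ 2 * powerSum m 4 := by
  induction m using Multiset.induction_on with
  | empty => simp [powerSum]
  | cons μ m ih =>
    rw [powerSum_cons, powerSum_cons, powerSum_cons]
    have : 0 ≤ (μ ^ 2 * (μ - θ)) ^ 2 := sq_nonneg _
    linear_combination ih + this

lemma powerSum_erase_quadratic_nonneg {m : Multiset ℝ} {x : ℝ} (hx : x ∈ m) (θ : ℝ) :
    0 ≤ (powerSum m 6 - x ^ 6) - 2 * θ * (powerSum m 5 - x ^ 5) +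
      θ ^ 2 * (powerSum m 4 - x ^ 4) := by
  obtain ⟨m', rfl⟩ := Multiset.exists_cons_of_mem hx
  simpa only [powerSum_cons, add_sub_cancel_left] using powerSum_quadratic_nonneg m' θ

/-- If all power sums of a sequence of positive multisets converge, then so do their maxima. -/
lemma exists_tendsto_of_tendsto_powerSum {x : ℕ → ℝ} {m : ℕ → Multiset ℝ} {σ : ℕ → ℝ}
    (hσ : ∀ k, Tendsto (fun n => powerSum (m n) (k + 1)) atTop (𝓝 (σ (k + 1))))
    (hσ1 : 0 < σ 1) (hm : ∀ᶠ n in atTop, ∀ μ ∈ m n, 0 < μ ∧ μ ≤ x n)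
    (hx : ∀ᶠ n in atTop, m n ≠ 0 → x n ∈ m n) :
    ∃ L, Tendsto x atTop (𝓝 L) ∧ (∀ k, σ (k + 2) ≤ L * σ (k + 1)) ∧
      (∀ k, L ^ (k + 1) ≤ σ (k + 1)) ∧
      ∀ θ, 0 ≤ (σ 6 - L ^ 6) - 2 * θ * (σ 5 - L ^ 5) + θ ^ 2 * (σ 4 - L ^ 4) := by
  have hx' : ∀ᶠ n in atTop, x n ∈ m n := by
    filter_upwards [hx, (hσ 0).eventually (lt_mem_nhds hσ1)] with n h1 h2
    refine h1 ?_
    rintro h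
    simp [h, powerSum] at h2
  have hpos : ∀ᶠ n in atTop, 0 < x n := by
    filter_upwards [hm, hx'] with n h1 h2 using (h1 _ h2).1
  have hpow : ∀ᶠ n in atTop, ∀ k, x n ^ k ≤ powerSum (m n) k := by
    filter_upwards [hm, hx'] with n h1 h2 k using pow_le_powerSum (fun μ hμ => (h1 μ hμ).1) h2 k
  have hmul : ∀ᶠ n in atTop, ∀ k, powerSum (m n) (k + 1) ≤ x n * powerSum (m n) k := by
    filter_upwards [hm] with n h1 k using powerSum_succ_le h1 k
  have hlim : ∃ L, Tendsto x atTop (𝓝 L) := by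
    refine tendsto_of_no_upcrossings dense_univ ?_ ?_ ?_
    · rintro a - b - hab ⟨ha, hb⟩
      have ha0 : 0 < a := by
        obtain ⟨n, h1, h2⟩ := (ha.and_eventually hpos).exists
        exact h2.trans h1
      have hb0 : 0 < b := ha0.trans hab
      have h1 : ∀ k, b ^ (k + 1) ≤ σ (k + 1) := by
        intro k
        refine ge_of_tendsto_of_frequently (hσ k) ?_
        refine (hb.and_eventually hpow).mono fun n hn => ?_
        exact (pow_le_pow_left₀ hb0.le hn.1.le _).trans (hn.2 _)
      have h2 : ∀ k, σ (k + 1) ≤ a ^ k * σ 1 := by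
        intro k
        induction k with
        | zero => simp
        | succ k ih =>
          have h3 : σ (k + 2) ≤ a * σ (k + 1) := by
            refine le_of_tendsto_of_frequently
              (f := fun n => powerSum (m n) (k + 2) - a * powerSum (m n) (k + 1))
              ((hσ (k + 1)).sub ((hσ k).const_mul a)) (b := 0) ?_ |> sub_nonpos.1
            refine ((ha.and_eventually hmul).and_eventually (hpow.and hpos)).mono ?_
            rintro n ⟨⟨h3, h4⟩, h5, h6⟩
            have h7 : 0 ≤ powerSum (m n) (k + 1) := (pow_nonneg h6.le _).trans (h5 _)
            have := h4 (k + 1)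
            have := mul_le_mul_of_nonneg_right h3.le h7
            linarith
          calc σ (k + 2) ≤ a * σ (k + 1) := h3
            _ ≤ a * (a ^ k * σ 1) := mul_le_mul_of_nonneg_left ih ha0.le
            _ = a ^ (k + 1) * σ 1 := by ring
      have h3 : Tendsto (fun k : ℕ => (b / a) ^ k) atTop atTop :=
        tendsto_pow_atTop_atTop_of_one_lt ((one_lt_div ha0).2 hab)
      obtain ⟨k, hk⟩ := (h3.eventually_gt_atTop (σ 1 / b)).exists
      have h4 := (h1 k).trans (h2 k)
      rw [div_pow, div_lt_div_iff₀ hb0 (pow_pos ha0 k)] at hk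
      rw [pow_succ] at h4
      linarith
    · obtain ⟨B, hB⟩ := (hσ 0).isBoundedUnder_le
      refine ⟨B, ?_⟩
      rw [eventually_map] at hB ⊢
      filter_upwards [hB, hpow] with n h1 h2
      have := h2 1
      rw [pow_one] at this
      exact this.trans h1
    · refine ⟨0, ?_⟩
      rw [eventually_map]
      filter_upwards [hpos] with n hn using hn.le
  obtain ⟨L, hL⟩ := hlim
  refine ⟨L, hL, fun k => ?_, fun k => ?_, fun θ => ?_⟩
  · exact le_of_tendsto_of_tendsto (hσ (k + 1)) (hL.mul (hσ k)) (hmul.mono fun n h => h (k + 1))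
  · exact le_of_tendsto_of_tendsto (hL.pow _) (hσ k) (hpow.mono fun n h => h (k + 1))
  · refine ge_of_tendsto ((((hσ 5).sub (hL.pow 6)).sub (((hσ 4).sub (hL.pow 5)).const_mul
      (2 * θ))).add (((hσ 3).sub (hL.pow 4)).const_mul (θ ^ 2))) ?_
    filter_upwards [hx'] with n hn using powerSum_erase_quadratic_nonneg hn θ

/-! ### Rayleigh sums -/

/-- The closed forms of the Rayleigh sums used below. -/
lemma rayleigh_sums {α : ℝ} {σ : ℕ → ℝ} (hα : -1 < α)
    (hrec : ∀ k : ℕ, σ (k + 1) = -(k + 1) * spectralLimit α (k + 1) -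
        ∑ i ∈ Finset.range k, spectralLimit α (i + 1) * σ (k - i)) :
    σ 1 = 1 / (2 * (α + 1)) ∧
    σ 5 = (7 * α + 31) / ((α + 1) ^ 5 * (α + 3) ^ 2 * (α + 5) * (α + 7) * (α + 9)) ∧
    σ 6 = (21 * α ^ 3 + 299 * α ^ 2 + 1391 * α + 2073) /
      ((α + 1) ^ 6 * (α + 3) ^ 3 * (α + 5) ^ 2 * (α + 7) * (α + 9) * (α + 11)) ∧
    σ 7 = (66 * α ^ 3 + 1118 * α ^ 2 + 6214 * α + 10922) /
      ((α + 1) ^ 7 * (α + 3) ^ 3 * (α + 5) ^ 2 * (α + 7) * (α + 9) * (α + 11) * (α + 13)) := by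
  have n1 : α + 1 ≠ 0 := by linarith
  have n3 : α + 3 ≠ 0 := by linarith
  have n5 : α + 5 ≠ 0 := by linarith
  have n7 : α + 7 ≠ 0 := by linarith
  have n9 : α + 9 ≠ 0 := by linarith
  have n11 : α + 11 ≠ 0 := by linarith
  have n13 : α + 13 ≠ 0 := by linarith
  have f1 : spectralLimit α 1 = -1 / (2 * (α + 1)) := by
    norm_num [spectralLimit, add_comm]
  have f2 : spectralLimit α 2 = 1 / (8 * ((α + 1) * (α + 3))) := by
    rw [spectralLimit, f1, show (2 * ((1 : ℕ) : ℝ) + 1 + α) = α + 3 by push_cast; ring]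
    push_cast; field_simp; norm_num
  have f3 : spectralLimit α 3 = -1 / (48 * ((α + 1) * (α + 3) * (α + 5))) := by
    rw [spectralLimit, f2, show (2 * ((2 : ℕ) : ℝ) + 1 + α) = α + 5 by push_cast; ring]
    push_cast; field_simp; norm_num
  have f4 : spectralLimit α 4 = 1 / (384 * ((α + 1) * (α + 3) * (α + 5) * (α + 7))) := by
    rw [spectralLimit, f3, show (2 * ((3 : ℕ) : ℝ) + 1 + α) = α + 7 by push_cast; ring]
    push_cast; field_simp; norm_num
  have f5 : spectralLimit α 5 =
      -1 / (3840 * ((α + 1) * (α + 3) * (α + 5) * (α + 7) * (α + 9))) := by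
    rw [spectralLimit, f4, show (2 * ((4 : ℕ) : ℝ) + 1 + α) = α + 9 by push_cast; ring]
    push_cast; field_simp; norm_num
  have f6 : spectralLimit α 6 =
      1 / (46080 * ((α + 1) * (α + 3) * (α + 5) * (α + 7) * (α + 9) * (α + 11))) := by
    rw [spectralLimit, f5, show (2 * ((5 : ℕ) : ℝ) + 1 + α) = α + 11 by push_cast; ring]
    push_cast; field_simp; norm_num
  have f7 : spectralLimit α 7 =
      -1 / (645120 * ((α + 1) * (α + 3) * (α + 5) * (α + 7) * (α + 9) * (α + 11) * (α + 13))) := by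
    rw [spectralLimit, f6, show (2 * ((6 : ℕ) : ℝ) + 1 + α) = α + 13 by push_cast; ring]
    push_cast; field_simp; norm_num
  have s1 : σ 1 = 1 / (2 * (α + 1)) := by
    have h := hrec 0
    norm_num [Finset.sum_range_succ, f1] at h
    rw [h]; field_simp
  have s2 : σ 2 = 1 / (2 * ((α + 1) ^ 2 * (α + 3))) := by
    have h := hrec 1
    norm_num [Finset.sum_range_succ, f1, f2, s1] at h
    rw [h]; field_simp; ring
  have s3 : σ 3 = 1 / ((α + 1) ^ 3 * (α + 3) * (α + 5)) := by
    have h := hrec 2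
    norm_num [Finset.sum_range_succ, f1, f2, f3, s1, s2] at h
    rw [h]; field_simp; ring
  have s4 : σ 4 = (5 * α + 17) / (2 * ((α + 1) ^ 4 * (α + 3) ^ 2 * (α + 5) * (α + 7))) := by
    have h := hrec 3
    norm_num [Finset.sum_range_succ, f1, f2, f3, f4, s1, s2, s3] at h
    rw [h]; field_simp; ring
  have s5 : σ 5 = (7 * α + 31) /
      ((α + 1) ^ 5 * (α + 3) ^ 2 * (α + 5) * (α + 7) * (α + 9)) := by
    have h := hrec 4
    norm_num [Finset.sum_range_succ, f1, f2, f3, f4, f5, s1, s2, s3, s4] at h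
    rw [h]; field_simp; ring
  have s6 : σ 6 = (21 * α ^ 3 + 299 * α ^ 2 + 1391 * α + 2073) /
      ((α + 1) ^ 6 * (α + 3) ^ 3 * (α + 5) ^ 2 * (α + 7) * (α + 9) * (α + 11)) := by
    have h := hrec 5
    norm_num [Finset.sum_range_succ, f1, f2, f3, f4, f5, f6, s1, s2, s3, s4, s5] at h
    rw [h]; field_simp; ring
  refine ⟨s1, s5, s6, ?_⟩
  have h := hrec 6
  norm_num [Finset.sum_range_succ, f1, f2, f3, f4, f5, f6, f7, s1, s2, s3, s4, s5, s6] at h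
  rw [h]; field_simp; ring

lemma rayleigh_numerator_pos {α : ℝ} (hα : -1 < α) :
    0 < 21 * α ^ 3 + 299 * α ^ 2 + 1391 * α + 2073 := by
  have n1 : 0 < α + 1 := by linarith
  rw [show 21 * α ^ 3 + 299 * α ^ 2 + 1391 * α + 2073 =
    21 * (α + 1) ^ 3 + 236 * (α + 1) ^ 2 + 856 * (α + 1) + 960 by ring]
  positivity

/-- The limit of the normalised squared Markov constants and its bounds by Rayleigh sums. -/
theorem exists_tendsto_markovConst_sq {α : ℝ} (hα : -1 < α) :
    ∃ L, Tendsto (fun n : ℕ => markovConst n α ^ 2 / (n : ℝ) ^ 2) atTop (𝓝 L) ∧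
      lowerSq α < L ∧ L ^ 6 < (21 * α ^ 3 + 299 * α ^ 2 + 1391 * α + 2073) /
      ((α + 1) ^ 6 * (α + 3) ^ 3 * (α + 5) ^ 2 * (α + 7) * (α + 9) * (α + 11)) := by
  choose hlub m hm hmax hprod using fun n => exists_markov_spectrum hα n
  obtain ⟨σ, hσ, hrec⟩ := exists_tendsto_powerSum hα hprod
  obtain ⟨s1, s5, s6, s7⟩ := rayleigh_sums hα hrec
  obtain ⟨t, rfl⟩ : ∃ t, α = t - 1 := ⟨α + 1, by ring⟩
  have ht : 0 < t := by linarith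
  have n3 : 0 < t - 1 + 3 := by linarith
  have n5 : 0 < t - 1 + 5 := by linarith
  have n7 : 0 < t - 1 + 7 := by linarith
  have n9 : 0 < t - 1 + 9 := by linarith
  have n11 : 0 < t - 1 + 11 := by linarith
  have n13 : 0 < t - 1 + 13 := by linarith
  have n31 : 0 < 7 * (t - 1) + 31 := by linarith
  have hN6 := rayleigh_numerator_pos hα
  rw [sub_add_cancel] at s1 s5 s6 s7 ⊢
  have p5 : 0 < σ 5 := by rw [s5]; positivity
  have p6 : 0 < σ 6 := by rw [s6]; positivity
  obtain ⟨L, hL, hmul, hpow, hquad⟩ := exists_tendsto_of_tendsto_powerSum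
    (x := fun n : ℕ => markovConst n (t - 1) ^ 2 / (n : ℝ) ^ 2) hσ (by rw [s1]; positivity)
    (by
      filter_upwards [eventually_gt_atTop 0] with n hn μ hμ
      obtain ⟨ν, hν, rfl⟩ := Multiset.mem_map.1 hμ
      have hn' : (0 : ℝ) < n := Nat.cast_pos.2 hn
      exact ⟨div_pos (hm n ν hν).1 (by positivity),
        div_le_div_of_nonneg_right (hm n ν hν).2 (by positivity)⟩)
    (Eventually.of_forall fun n hn => Multiset.mem_map.2
      ⟨_, hmax n (by rintro h; simp [h] at hn), rfl⟩)
  have hlow : lowerSq (t - 1) = σ 6 / σ 5 := by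
    rw [s5, s6, lowerSq, sub_add_cancel]
    field_simp
  have hlt : σ 6 / σ 5 < L := by
    have h1 : σ 6 / σ 5 < σ 7 / σ 6 := by
      rw [div_lt_div_iff₀ p5 p6, ← sub_pos]
      have e : σ 7 * σ 5 - σ 6 * σ 6 =
          (21 * t ^ 7 + 212 * t ^ 6 + 520 * t ^ 5) /
          (t ^ 12 * (t - 1 + 3) ^ 6 * (t - 1 + 5) ^ 4 * (t - 1 + 7) ^ 2 * (t - 1 + 9) ^ 2 *
            (t - 1 + 11) ^ 2 * (t - 1 + 13)) := by
        rw [s5, s6, s7]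
        field_simp
        ring
      rw [e]
      positivity
    refine h1.trans_le ?_
    rw [div_le_iff₀ p6]
    exact hmul 5
  refine ⟨L, hL, hlow ▸ hlt, ?_⟩
  rw [← s6]
  refine lt_of_le_of_ne (hpow 5) fun h6 => ?_
  have hL0 : 0 < L := (div_pos p6 p5).trans hlt
  have hA : 0 ≤ σ 5 - L ^ 5 := sub_nonneg.2 (hpow 4)
  have hB : 0 ≤ σ 4 - L ^ 4 := sub_nonneg.2 (hpow 3)
  have hA0 : σ 5 - L ^ 5 = 0 := by
    by_contra hne
    have hA' : 0 < σ 5 - L ^ 5 := lt_of_le_of_ne hA (Ne.symm hne)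
    have h := hquad ((σ 5 - L ^ 5) / (σ 4 - L ^ 4 + 1))
    rw [← h6, show L ^ (5 + 1) = L ^ 6 from rfl, sub_self] at h
    generalize σ 5 - L ^ 5 = A at *
    generalize σ 4 - L ^ 4 = B at *
    have e : 0 - 2 * (A / (B + 1)) * A + (A / (B + 1)) ^ 2 * B =
        -(A ^ 2 * (B + 2) / (B + 1) ^ 2) := by
      field_simp
      ring
    rw [e] at h
    have : 0 < A ^ 2 * (B + 2) / (B + 1) ^ 2 := by positivity
    linarith
  rw [div_lt_iff₀ p5, ← h6, sub_eq_zero.1 hA0] at hlt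
  exact absurd hlt (by rw [← pow_succ']; exact lt_irrefl _)

/-! ### Large parameters -/

lemma riccati_step {R : ℝ} (hR : 0 ≤ R) (x y : ℝ) :
    (R - R ^ 2) * x ^ 2 ≤ (x - y) ^ 2 + R * y ^ 2 := by
  have h : (1 + R) * ((x - y) ^ 2 + R * y ^ 2 - (R - R ^ 2) * x ^ 2) =
      ((1 + R) * y - x) ^ 2 + R ^ 3 * x ^ 2 := by ring
  have h1 : 0 ≤ (1 + R) * ((x - y) ^ 2 + R * y ^ 2 - (R - R ^ 2) * x ^ 2) := by
    rw [h]; positivity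
  linarith [nonneg_of_mul_nonneg_right h1 (by linarith : 0 < 1 + R)]

/-- The continuous Riccati inequality for the supersolution `77/200 + 23/200 * x ^ 20`. -/
lemma riccati_large {α x : ℝ} (hα : 171 ≤ α) (hx0 : 0 ≤ x) (hx1 : x ≤ 1) :
    (α ^ 2 + 10 * α) / 4 + 4 ≤
      α ^ 2 * ((77 / 200 + 23 / 200 * x ^ 20) - x ^ 2 * (77 / 200 + 23 / 200 * x ^ 20) ^ 2) +
        α * (77 / 200 + 483 / 200 * x ^ 20) := by
  obtain ⟨y, hy⟩ : ∃ y, y = x ^ 2 := ⟨_, rfl⟩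
  obtain ⟨w, hw⟩ : ∃ w, w = x ^ 20 := ⟨_, rfl⟩
  have hwy : w = y ^ 10 := by rw [hw, hy, ← pow_mul]
  have hy0 : 0 ≤ y := by rw [hy]; positivity
  have hw0 : 0 ≤ w := by rw [hw]; positivity
  have hw1 : w ≤ 1 := by rw [hw]; exact pow_le_one₀ hx0 hx1
  have hb1 : y ≤ 9 / 10 + w / 10 := by
    have := one_add_mul_le_pow (a := y - 1) (by linarith) 10
    rw [add_sub_cancel, ← hwy] at this
    push_cast at this
    linarith
  have hb2 : y ≤ 81 / 100 + 13 / 50 * w := by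
    have := one_add_mul_le_pow (a := y / (9 / 10) - 1)
      (by linarith [div_nonneg hy0 (by norm_num : (0 : ℝ) ≤ 9 / 10)]) 10
    rw [add_sub_cancel, div_pow, ← hwy] at this
    push_cast at this
    norm_num at this
    linarith
  rw [← hy, ← hw]
  set s := 77 / 200 + 23 / 200 * w with hs
  obtain ⟨f, hf0, hf1, hf2⟩ : ∃ f, 0 ≤ f ∧ f ≤ s - y * s ^ 2 - 1 / 4 ∧
      3 / 100 ≤ 171 * f + (77 / 200 + 483 / 200 * w - 5 / 2) := by
    have hs2 : 0 ≤ s ^ 2 := sq_nonneg s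
    rcases le_total (9 / 16) w with h | h
    · refine ⟨s - (9 / 10 + w / 10) * s ^ 2 - 1 / 4, ?_, ?_, ?_⟩
      · rw [hs]; nlinarith [mul_nonneg (sub_nonneg.2 h) (sub_nonneg.2 hw1)]
      · linarith [mul_le_mul_of_nonneg_right hb1 hs2]
      · rw [hs]; nlinarith [mul_nonneg (sub_nonneg.2 h) (sub_nonneg.2 hw1)]
    · refine ⟨s - (81 / 100 + 13 / 50 * w) * s ^ 2 - 1 / 4, ?_, ?_, ?_⟩
      · rw [hs]; nlinarith [mul_nonneg (sub_nonneg.2 h) hw0]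
      · linarith [mul_le_mul_of_nonneg_right hb2 hs2]
      · rw [hs]; nlinarith [mul_nonneg (sub_nonneg.2 h) hw0]
  have h1 : 171 * f ≤ α * f := mul_le_mul_of_nonneg_right hα hf0
  have h2 : α * (3 / 100) ≤ α * (α * f + (77 / 200 + 483 / 200 * w - 5 / 2)) :=
    mul_le_mul_of_nonneg_left (by linarith) (by linarith)
  have h3 : α ^ 2 * f ≤ α ^ 2 * (s - y * s ^ 2 - 1 / 4) :=
    mul_le_mul_of_nonneg_left hf1 (sq_nonneg _)
  linarith

/-- A discrete lower bound for the derivative of `x ^ 21`. -/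
lemma pow_succ_sub_pow_le {m n : ℝ} (hm : 1 ≤ m) (hmn : m ≤ n) :
    21 * (m / n) ^ 20 - 420 / n ≤ m * (m / n) ^ 20 - (m - 1) * ((m - 1) / n) ^ 20 := by
  have hn : 0 < n := by linarith
  have h1 : (m - 1) ^ 21 + 21 * (m - 1) ^ 20 ≤ m ^ 21 := by
    have hm0 : 0 ≤ m - 1 := by linarith
    have := pow_add_mul_le_add_pow hm0 (by linarith : 0 ≤ 2 * (m - 1) + 1) 21
    norm_num at this
    linarith
  have h2 : m ^ 20 - 20 * m ^ 19 ≤ (m - 1) ^ 20 := by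
    have := pow_add_mul_le_add_pow (by linarith : 0 ≤ m) (by linarith : 0 ≤ 2 * m + -1) 20
    norm_num at this
    linarith
  have h3 : m ^ 19 / n ^ 20 ≤ 1 / n := by
    rw [div_le_div_iff₀ (by positivity) hn]
    have := pow_le_pow_left₀ (by linarith : 0 ≤ m) hmn 19
    calc m ^ 19 * n ≤ n ^ 19 * n := mul_le_mul_of_nonneg_right this hn.le
      _ = 1 * n ^ 20 := by ring
  have h4 : 21 * m ^ 20 / n ^ 20 - 420 * (m ^ 19 / n ^ 20) ≤
      (m ^ 21 - (m - 1) ^ 21) / n ^ 20 := by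
    rw [mul_div_assoc', ← sub_div]
    exact div_le_div_of_nonneg_right (by linarith) (by positivity)
  have e : m * (m / n) ^ 20 - (m - 1) * ((m - 1) / n) ^ 20 =
      (m ^ 21 - (m - 1) ^ 21) / n ^ 20 := by
    rw [div_pow, div_pow]; ring
  rw [e, div_pow, ← mul_div_assoc]
  have : 420 * (m ^ 19 / n ^ 20) ≤ 420 / n := by rw [← mul_one_div 420 n]; linarith
  linarith

lemma hardy_large {α : ℝ} (hα : 171 ≤ α) {n : ℕ} (hn : 50 * α + α ^ 3 ≤ n)
    {u : ℕ → ℝ} (hu : u n = 0) :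
    ((α ^ 2 + 10 * α) / 4 + 3) / (n : ℝ) ^ 2 * ∑ k ∈ Finset.range n, laguerreH α k * u k ^ 2 ≤
      ∑ k ∈ Finset.range n, laguerreH α (k + 1) * (u k - u (k + 1)) ^ 2 := by
  have hα' : -1 < α := by linarith
  have hn0 : (0 : ℝ) < n := lt_of_lt_of_le (by positivity) hn
  refine hardy_of_riccati hα' (ρ := fun k => k / (n : ℝ) ^ 2 *
    (α * (77 / 200 + 23 / 200 * (k / (n : ℝ)) ^ 20))) (by simp) (fun k hk x y => ?_) hu
  push_cast
  have hkn : (k : ℝ) + 1 ≤ n := by exact_mod_cast hk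
  have hm1 : (1 : ℝ) ≤ k + 1 := by have : (0 : ℝ) ≤ k := k.cast_nonneg; linarith
  have hH := laguerreH_succ hα' k
  have hHk := laguerreH_pos hα' k
  have hHk' := laguerreH_pos hα' (k + 1)
  have hdiff := pow_succ_sub_pow_le hm1 hkn
  have hx1 : ((k : ℝ) + 1) / n ≤ 1 := (div_le_one hn0).2 hkn
  have hx0 : 0 ≤ ((k : ℝ) + 1) / n := by positivity
  have hric := riccati_large hα hx0 hx1
  rw [add_sub_cancel_right] at hdiff
  have hw1 : (((k : ℝ) + 1) / n) ^ 20 ≤ 1 := pow_le_one₀ hx0 hx1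
  have hw0 : 0 ≤ (((k : ℝ) + 1) / n) ^ 20 := by positivity
  obtain ⟨m, hm⟩ : ∃ m : ℝ, m = k + 1 := ⟨_, rfl⟩
  have hk' : (k : ℝ) = m - 1 := by linarith
  rw [← hm] at hkn hm1 hH hdiff hx1 hx0 hric hw1 hw0 ⊢
  generalize (m / (n : ℝ)) ^ 20 = w at *
  generalize ((k : ℝ) / (n : ℝ)) ^ 20 = w' at *
  generalize laguerreH α k = H at *
  generalize laguerreH α (k + 1) = H' at *
  set s := 77 / 200 + 23 / 200 * w with hs
  have hs0 : 0 ≤ s := by positivity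
  have hs1 : s ≤ 1 / 2 := by linarith
  set R := m / (n : ℝ) ^ 2 * (α * s) with hR
  have hR0 : 0 ≤ R := by
    have : 0 ≤ α := by linarith
    positivity
  refine le_trans ?_ (mul_le_mul_of_nonneg_left (riccati_step hR0 x y) hHk'.le)
  rw [← mul_assoc H']
  refine mul_le_mul_of_nonneg_right ?_ (sq_nonneg x)
  have key : (α ^ 2 + 10 * α) / 4 + 3 + k * (α * (77 / 200 + 23 / 200 * w')) ≤
      (m + α) * (α * s - m / (n : ℝ) ^ 2 * (α * s) ^ 2) := by
    have h1 : (m + α) * (m / (n : ℝ) ^ 2) ≤ (m / n) ^ 2 + α / n := by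
      have : α * (m / (n : ℝ) ^ 2) ≤ α / n := by
        rw [pow_two, ← div_div, ← mul_div_assoc]
        refine div_le_div_of_nonneg_right ?_ hn0.le
        calc α * (m / n) ≤ α * 1 := mul_le_mul_of_nonneg_left hx1 (by linarith)
          _ = α := mul_one α
      have e : m * (m / (n : ℝ) ^ 2) = (m / n) ^ 2 := by rw [div_pow]; ring
      rw [add_mul, e]
      linarith
    have h2 : (α * s) ^ 2 ≤ α ^ 2 * (1 / 4) := by
      rw [mul_pow]
      refine mul_le_mul_of_nonneg_left ?_ (sq_nonneg α)
      calc s ^ 2 ≤ (1 / 2) ^ 2 := pow_le_pow_left₀ hs0 hs1 2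
        _ = 1 / 4 := by norm_num
    have h3 := mul_le_mul_of_nonneg_right h1 (sq_nonneg (α * s))
    have h4 : α / n * (α * s) ^ 2 ≤ α / n * (α ^ 2 * (1 / 4)) :=
      mul_le_mul_of_nonneg_left h2 (div_nonneg (by linarith) hn0.le)
    have h5 : α * (23 / 200) * (21 * w - 420 / n) ≤ α * (23 / 200) * (m * w - k * w') :=
      mul_le_mul_of_nonneg_left hdiff (by linarith)
    have h6 : (50 * α + α ^ 3) / n ≤ 1 := (div_le_one hn0).2 hn
    have h7 : 0 ≤ α / n := div_nonneg (by linarith) hn0.le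
    have h8 : 0 ≤ α ^ 3 / n := div_nonneg (by positivity) hn0.le
    have e1 : α / n * (α ^ 2 * (1 / 4)) = α ^ 3 / n / 4 := by ring
    have e2 : α * (23 / 200) * (21 * w - 420 / n) = α * (483 / 200) * w - 483 / 10 * (α / n) := by
      ring
    rw [add_div, mul_div_assoc] at h6
    rw [e1] at h4
    rw [e2] at h5
    have e3 : (m + α) * (α * s - m / (n : ℝ) ^ 2 * (α * s) ^ 2) -
        k * (α * (77 / 200 + 23 / 200 * w')) = α ^ 2 * s + α * (77 / 200)
          + α * (23 / 200) * (m * w - k * w') - (m + α) * (m / (n : ℝ) ^ 2) * (α * s) ^ 2 := by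
      rw [hs, hk']; ring
    have e4 : ((m / n) ^ 2 + α / n) * (α * s) ^ 2 =
      α ^ 2 * ((m / n) ^ 2 * s ^ 2) + α / n * (α * s) ^ 2 := by ring
    rw [e4] at h3
    linarith
  have hm0 : 0 < m := by linarith
  have hn2 : (0 : ℝ) < (n : ℝ) ^ 2 := by positivity
  have h9 : m * (H * (((α ^ 2 + 10 * α) / 4 + 3) / (n : ℝ) ^ 2 +
      k / (n : ℝ) ^ 2 * (α * (77 / 200 + 23 / 200 * w')))) ≤ m * (H' * (R - R ^ 2)) := by
    rw [← mul_assoc m H', hH]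
    have e5 : m * (H * (((α ^ 2 + 10 * α) / 4 + 3) / (n : ℝ) ^ 2 +
        k / (n : ℝ) ^ 2 * (α * (77 / 200 + 23 / 200 * w')))) = m * H / (n : ℝ) ^ 2 *
        ((α ^ 2 + 10 * α) / 4 + 3 + k * (α * (77 / 200 + 23 / 200 * w'))) := by ring
    have e6 : (m + α) * H * (R - R ^ 2) = m * H / (n : ℝ) ^ 2 *
        ((m + α) * (α * s - m / (n : ℝ) ^ 2 * (α * s) ^ 2)) := by
      rw [hR]; ring
    rw [e5, e6]
    exact mul_le_mul_of_nonneg_left key (by positivity)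
  exact le_of_mul_le_mul_left h9 hm0

/-- The upper bound for large parameters. -/
lemma limit_lt_upperSqLarge {α L : ℝ} (hα : 171 ≤ α)
    (hL : Tendsto (fun n : ℕ => markovConst n α ^ 2 / (n : ℝ) ^ 2) atTop (𝓝 L)) :
    L < upperSqLarge α := by
  have hpos : 0 < (α ^ 2 + 10 * α) / 4 + 3 := by positivity
  have hle : L ≤ ((α ^ 2 + 10 * α) / 4 + 3)⁻¹ := by
    refine le_of_tendsto hL ?_
    filter_upwards [tendsto_natCast_atTop_atTop.eventually_ge_atTop (50 * α + α ^ 3)] with n hn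
    have hn0 : (0 : ℝ) < n := lt_of_lt_of_le (by positivity) hn
    have h := (isLUB_markovConst (by linarith) (by positivity)
      fun u hu => hardy_large hα hn hu).2
    rw [inv_div] at h
    rw [div_le_iff₀ (by positivity), inv_mul_eq_div]
    exact h
  refine hle.trans_lt ?_
  rw [upperSqLarge, inv_eq_one_div, div_lt_div_iff₀ hpos (by positivity)]
  linarith

/-! ### The switching point -/

/-- A polynomial with a single sign change, in its leading coefficient, stays positive once it is
nonnegative. -/
lemma sum_mul_pow_lt_of_lt {N : ℕ} {c : Fin N → ℝ} (hc : ∀ i, 0 < c i) (hN : 0 < N) {l a b : ℝ}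
    (ha : 0 < a) (hab : a < b) (h : ∑ i, c i * a ^ (i : ℕ) ≤ l * a ^ N) :
    ∑ i, c i * b ^ (i : ℕ) < l * b ^ N := by
  have hb : 0 < b := ha.trans hab
  have h1 : a ^ N * ∑ i, c i * b ^ (i : ℕ) < b ^ N * ∑ i, c i * a ^ (i : ℕ) := by
    rw [Finset.mul_sum, Finset.mul_sum]
    refine Finset.sum_lt_sum_of_nonempty ⟨⟨0, hN⟩, Finset.mem_univ _⟩ fun i _ => ?_
    have h2 : a ^ (N - i) < b ^ (N - i) :=
      pow_lt_pow_left₀ hab ha.le (by have := i.2; omega)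
    have e : ∀ x : ℝ, x ^ N = x ^ (N - i) * x ^ (i : ℕ) := fun x => by
      rw [← pow_add, Nat.sub_add_cancel i.2.le]
    rw [e a, e b]
    have h3 := mul_lt_mul_of_pos_right h2
      (mul_pos (hc i) (mul_pos (pow_pos ha (i : ℕ)) (pow_pos hb (i : ℕ))))
    calc _ = a ^ (N - i) * (c i * (a ^ (i : ℕ) * b ^ (i : ℕ))) := by ring
      _ < b ^ (N - i) * (c i * (a ^ (i : ℕ) * b ^ (i : ℕ))) := h3
      _ = _ := by ring
  have h2 : b ^ N * ∑ i, c i * a ^ (i : ℕ) ≤ b ^ N * (l * a ^ N) :=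
    mul_le_mul_of_nonneg_left h (pow_pos hb N).le
  refine lt_of_mul_lt_mul_left (a := a ^ N) ?_ (pow_pos ha N).le
  calc _ < b ^ N * (l * a ^ N) := h1.trans_le h2
    _ = _ := by ring

/-- The polynomial whose sign compares the two upper bounds. -/
def crossing (α : ℝ) : ℝ :=
  (21 * α ^ 3 + 299 * α ^ 2 + 1391 * α + 2073) * (α ^ 2 + 10 * α + 8) ^ 6 -
    4 ^ 6 * ((α + 1) ^ 6 * (α + 3) ^ 3 * (α + 5) ^ 2 * (α + 7) * (α + 9) * (α + 11))

/-- The negatives of the lower coefficients of `crossing` in the variable `10 * α + 9`. -/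
def crossingCoeff : Fin 15 → ℝ :=
  ![318166521660749499, 1983845411809823965, 5206339093274625115, 7584104137123279725,
    6100399135573824855, 3564549445891750977, 616508385478060455, 74791408135569505,
    6185139595961425, 317663868346935, 9979897181457, 190782372615, 2143452765, 12740075,
    28205]

lemma crossing_eq (α : ℝ) : 10 ^ 15 * crossing α =
    21 * (10 * α + 9) ^ 15 - ∑ i, crossingCoeff i * (10 * α + 9) ^ (i : ℕ) := by
  obtain ⟨t, rfl⟩ : ∃ t, α = (t - 9) / 10 := ⟨10 * α + 9, by ring⟩
  rw [show 10 * ((t - 9) / 10) + 9 = t by ring]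
  simp only [Fin.sum_univ_succ, crossingCoeff, crossing]
  simp
  ring

lemma crossing_pos_of_lt {a b : ℝ} (ha : -(9 / 10) < a) (hab : a < b) (h : 0 ≤ crossing a) :
    0 < crossing b := by
  have hc : ∀ i, 0 < crossingCoeff i := by
    intro i
    fin_cases i <;> simp [crossingCoeff]
  have h1 := crossing_eq a
  have h2 := crossing_eq b
  have := sum_mul_pow_lt_of_lt hc (by norm_num) (l := 21) (by linarith : 0 < 10 * a + 9)
    (by linarith : 10 * a + 9 < 10 * b + 9) (by linarith)
  linarith

lemma upperSqSmall_pos {α : ℝ} (hα : -1 < α) : 0 < upperSqSmall α := by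
  have n1 : 0 < α + 1 := by linarith
  have n3 : 0 < α + 3 := by linarith
  have n5 : 0 < α + 5 := by linarith
  have n7 : 0 < α + 7 := by linarith
  have n9 : 0 < α + 9 := by linarith
  have n11 : 0 < α + 11 := by linarith
  have hN := rayleigh_numerator_pos hα
  unfold upperSqSmall
  positivity

lemma upperSqSmall_pow {α : ℝ} (hα : -1 < α) :
    upperSqSmall α ^ 6 = (21 * α ^ 3 + 299 * α ^ 2 + 1391 * α + 2073) /
      ((α + 1) ^ 6 * (α + 3) ^ 3 * (α + 5) ^ 2 * (α + 7) * (α + 9) * (α + 11)) := by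
  have n1 : 0 < α + 1 := by linarith
  have n3 : 0 < α + 3 := by linarith
  have n5 : 0 < α + 5 := by linarith
  have n7 : 0 < α + 7 := by linarith
  have n9 : 0 < α + 9 := by linarith
  have n11 : 0 < α + 11 := by linarith
  have hN := rayleigh_numerator_pos hα
  have h6 : ∀ x : ℝ, 0 ≤ x → (x ^ (1 / 6 : ℝ)) ^ 6 = x := fun x hx => by
    rw [← Real.rpow_natCast, ← Real.rpow_mul hx]; norm_num
  have h3 : ∀ x : ℝ, 0 ≤ x → (x ^ (1 / 3 : ℝ)) ^ 6 = x ^ 2 := fun x hx => by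
    rw [← Real.rpow_natCast, ← Real.rpow_mul hx, ← Real.rpow_natCast]; norm_num
  have h2 : ∀ x : ℝ, 0 ≤ x → (x ^ (1 / 2 : ℝ)) ^ 6 = x ^ 3 := fun x hx => by
    rw [← Real.rpow_natCast, ← Real.rpow_mul hx, ← Real.rpow_natCast]; norm_num
  rw [upperSqSmall, div_pow, mul_pow, mul_pow, mul_pow, h6 _ hN.le, h6 _ (by positivity),
    h3 _ n5.le, h2 _ n3.le]
  congr 1
  ring

lemma upperSqSmall_eq_upperSqLarge_iff {α : ℝ} (hα : -1 < α) :
    upperSqSmall α = upperSqLarge α ↔ -(9 / 10) < α ∧ 0 < α ^ 2 + 10 * α + 8 ∧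
      crossing α = 0 := by
  have hs := upperSqSmall_pos hα
  rcases le_or_gt (α ^ 2 + 10 * α + 8) 0 with hq | hq
  · constructor
    · intro h
      have : upperSqLarge α ≤ 0 := div_nonpos_of_nonneg_of_nonpos (by norm_num) hq
      linarith
    · rintro ⟨-, h, -⟩
      linarith
  have hα' : -(9 / 10) < α := by
    by_contra! h
    nlinarith
  have n1 : 0 < α + 1 := by linarith
  have n3 : 0 < α + 3 := by linarith
  have n5 : 0 < α + 5 := by linarith
  have n7 : 0 < α + 7 := by linarith
  have n9 : 0 < α + 9 := by linarith
  have n11 : 0 < α + 11 := by linarith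
  have hl : 0 < upperSqLarge α := div_pos (by norm_num) hq
  rw [← pow_left_inj₀ hs.le hl.le (by norm_num : 6 ≠ 0), upperSqSmall_pow hα, upperSqLarge,
    div_pow, div_eq_div_iff (by positivity) (by positivity), ← sub_eq_zero]
  exact ⟨fun h => ⟨hα', hq, h⟩, fun h => h.2.2⟩

lemma exists_crossing_eq_zero : ∃ a : ℝ, |a - 172| < 1 / 10 ∧ crossing a = 0 := by
  have hcont : Continuous crossing := by unfold crossing; fun_prop
  have h1 : crossing (1719 / 10) < 0 := by norm_num [crossing]
  have h2 : 0 < crossing (1721 / 10) := by norm_num [crossing]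
  obtain ⟨a, ha, ha0⟩ := intermediate_value_Icc (by norm_num : (1719 / 10 : ℝ) ≤ 1721 / 10)
    hcont.continuousOn ⟨h1.le, h2.le⟩
  refine ⟨a, ?_, ha0⟩
  have h3 : 1719 / 10 ≠ a := by rintro rfl; linarith
  have h4 : a ≠ 1721 / 10 := by rintro rfl; linarith
  have h5 := lt_of_le_of_ne ha.1 h3
  have h6 := lt_of_le_of_ne ha.2 h4
  rw [abs_lt]
  constructor <;> linarith

end

theorem corollary1p3 :
    ∃ αs : ℝ, |αs - 172| < 1 / 10 ∧
      (∀ α : ℝ, -1 < α → (upperSqSmall α = upperSqLarge α ↔ α = αs)) ∧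
      ∀ α : ℝ, -1 < α →
        (∀ n : ℕ, IsLUB (markovQuotients n α) (markovConst n α)) ∧
        ∃ c : ℝ, Tendsto (fun n : ℕ => markovConst n α / (n : ℝ)) atTop (𝓝 c) ∧
          Real.sqrt (lowerSq α) < c ∧ c < Real.sqrt (upperSq αs α) := by
  obtain ⟨αs, hαs, hzero⟩ := exists_crossing_eq_zero
  have hlow := (abs_lt.1 hαs).1
  refine ⟨αs, hαs, fun α hα => ?_, fun α hα => ?_⟩
  · rw [upperSqSmall_eq_upperSqLarge_iff hα]
    constructor
    · rintro ⟨h1, -, h3⟩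
      rcases lt_trichotomy α αs with h | h | h
      · exact absurd hzero (crossing_pos_of_lt h1 h h3.ge).ne'
      · exact h
      · exact absurd h3 (crossing_pos_of_lt (by linarith) h hzero.ge).ne'
    · rintro rfl
      have : 0 < α := by linarith
      exact ⟨by linarith, by positivity, hzero⟩
  · have hlub := fun n => (exists_markov_spectrum hα n).1
    refine ⟨hlub, ?_⟩
    obtain ⟨L, hL, hL1, hL2⟩ := exists_tendsto_markovConst_sq hα
    have hlow0 : 0 < lowerSq α := by
      have hN := rayleigh_numerator_pos hα
      have n1 : 0 < α + 1 := by linarith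
      have n3 : 0 < α + 3 := by linarith
      have n5 : 0 < α + 5 := by linarith
      have n11 : 0 < α + 11 := by linarith
      have n31 : 0 < 7 * α + 31 := by linarith
      unfold lowerSq
      positivity
    refine ⟨√L, ?_, Real.sqrt_lt_sqrt hlow0.le hL1, Real.sqrt_lt_sqrt (hlow0.trans hL1).le ?_⟩
    · refine ((Real.continuous_sqrt.tendsto L).comp hL).congr fun n => ?_
      rw [Function.comp_apply, ← div_pow, Real.sqrt_sq]
      exact div_nonneg ((hlub n).1 (zero_mem_markovQuotients n α)) n.cast_nonneg
    · unfold upperSq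
      split_ifs with h
      · rw [← upperSqSmall_pow hα] at hL2
        exact lt_of_pow_lt_pow_left₀ 6 (upperSqSmall_pos hα).le hL2
      · exact limit_lt_upperSqLarge (by linarith) hL
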